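/- Let $\ell\ge 1$ and let $z_0,z_1,\dots,z_\ell\in\mathbb C$ be the successive vertices of a polygonal line in which consecutive segments $\overline{z_{p-1}z_p}$ and $\overline{z_pz_{p+1}}$ meet only at $z_p$ $(1\le p\le \ell-1)$. Let $0\le q\le \ell$ with $\operatorname{Im}\frac{z_q-z_0}{z_\ell-z_0}>0$, let $\Pi_0$ be the interior of the triangle with vertices $z_0,z_\ell,z_q$, and let $\Pi_1=\overline{\Pi_0}$. For $1\le j\le \ell$ let $S_j(w)=\frac{z_j-z_{j-1}}{z_\ell-z_0}(w-z_0)+z_{j-1}$ be the orientation preserving similitude with $S_j(z_0)=z_{j-1}$ and $S_j(z_\ell)=z_j$. The polygonal line is a *basic figure* if - $z_1,z_{\ell-1}\in\overline{z_0z_\ell}$ and $z_{\ell-1}\in\overline{z_1z_\ell}$; - every $z_j$ belongs to $\{z_q\}\cup\overline{z_0z_\ell}\cup\Pi_0$; - every $S_j$ is contractive, with ratio in $(0,1)$; - the sets $S_j(\Pi_0)$, $1\le j\le\ell$, are pairwise disjoint, and $S_j(z_q)\in\Pi_1$ for all $j$; - $S_j(\Pi_1)\cap(\overline{z_qz_0}\cup\overline{z_qz_\ell})=\emptyset$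 for $j\notin\{1,\ell,q,q+1\}$. With arguments taken in $[0,2\pi)$, its corner angles are $\theta_p=\arg\frac{S_p(z_q)-z_p}{S_{p+1}(z_q)-z_p}$ for $1\le p\le \ell-1$, with minimum $\theta_{\min}$, and its characteristic angle is $\xi=\theta_{\min}+\min(\eta_1,\eta_2)$, where $\eta_1=\arg\frac{S_q(z_q)-z_q}{z_0-z_q}$ and $\eta_2=\arg\frac{z_\ell-z_q}{S_{q+1}(z_q)-z_q}$. Let $\Lambda$ be the self-similar set of $S_1,\dots,S_\ell$, i.e. the unique non-empty compact set with $\Lambda=\bigcup_{j=1}^{\ell}S_j(\Lambda)$. If $\Lambda$ is an arc (a homeomorphic image of $[0,1]$) and $\xi>0$, then $\Lambda$ is called a *regular self-similar arc*. For $x,y\in\Lambda$ write $\Lambda(x,y)$ for the closed subarc between $x$ and $y$. **Theorem.** Let $\Lambda$ be a regular self-similar arc, generated as above by a basic figure with $\theta_{\min}>0$, and let $s=\dim_H\Lambda$. Then: 1. For every $t\ge 1$, $\Lambda$ is a $t$-quasi-arc: there is a constant $\lambda>0$ such that $(\operatorname{diam}\Lambda(x,y))^t\le\lambda|x-y|$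 for all $x,y\in\Lambda$. In particular $\Lambda$ is a quasi-arc (the case $t=1$). 2. $H^s(\Lambda)<\infty$, and the Hausdorff measure function $f(x)=H^s(\Lambda(z_0,x))$ is a strict Whitney function on $\Lambda$: there is a $C^1$ function $F:\mathbb R^2\to\mathbb R$ with $F|_\Lambda=f$ and $\nabla F=0$ on $\Lambda$, and $f$ is non-constant on $\Lambda$ and on each non-empty relatively open subset of $\Lambda$. -/

import Mathlib

open MeasureTheory

noncomputable section

/-! ### Arcs and quasi-arcs in the plane -/

/-- For an arc `E` parametrized by a homeomorphism `h : [0,1] → E` and points `x, y ∈ E`, the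
subarc of `E` lying between `x` and `y` (end points included). It does not depend on `h`. -/
def subarc {E : Set ℂ} (h : unitInterval ≃ₜ E) (x y : ℂ) : Set ℂ :=
  {w | ∃ a b c : unitInterval,
    (h a : ℂ) = x ∧ (h b : ℂ) = y ∧ c ∈ Set.uIcc a b ∧ (h c : ℂ) = w}

/-- `E` is a `t`-quasi-arc, `t ≥ 1`: it is an arc, and `|E(x,y)| ^ t ≤ lam * |x - y|` for all
`x, y ∈ E`, where `|E(x,y)|` is the diameter of the subarc between `x` and `y`. -/
def IsTQuasiArc (t : ℝ) (E : Set ℂ) : Prop :=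
  1 ≤ t ∧ ∃ h : unitInterval ≃ₜ E, ∃ lam : ℝ, 0 < lam ∧
    ∀ x ∈ E, ∀ y ∈ E, Metric.diam (subarc h x y) ^ t ≤ lam * dist x y

/-- A quasi-arc is a `1`-quasi-arc. -/
def IsQuasiArc (E : Set ℂ) : Prop := IsTQuasiArc 1 E

/-! ### Whitney functions -/

/-- `f` is a Whitney function on the connected set `E`: it is non-constant, and it is the
restriction to `E` of a `C¹` function on the plane whose gradient vanishes on `E`. -/
def IsWhitneyFunctionOn (E : Set ℂ) (f : E → ℝ) : Prop :=
  IsConnected E ∧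
  (∃ F : ℂ → ℝ, ContDiff ℝ 1 F ∧ (∀ x ∈ E, fderiv ℝ F x = 0) ∧ ∀ x : E, F x = f x) ∧
  ∃ x y : E, f x ≠ f y

/-- A strict Whitney function on `E` is a Whitney function on `E` that is non-constant on each
non-empty relatively open subset of `E`. -/
def IsStrictWhitneyFunctionOn (E : Set ℂ) (f : E → ℝ) : Prop :=
  IsWhitneyFunctionOn E f ∧
  ∀ U : Set E, IsOpen U → U.Nonempty → ∃ x ∈ U, ∃ y ∈ U, f x ≠ f y

/-! ### Basic figures -/

/-- The orientation preserving similitude `S_j` (for `1 ≤ j ≤ ℓ`) of the plane with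
`S_j (z 0) = z (j - 1)` and `S_j (z ℓ) = z j`. -/
def figureMap (ℓ : ℕ) (z : ℕ → ℂ) (j : ℕ) (w : ℂ) : ℂ :=
  (z j - z (j - 1)) / (z ℓ - z 0) * (w - z 0) + z (j - 1)

/-- The interior `Π₀` of the triangle with vertices `z 0`, `z ℓ`, `z q`. -/
def openTriangle (ℓ q : ℕ) (z : ℕ → ℂ) : Set ℂ :=
  interior (convexHull ℝ {z 0, z ℓ, z q})

/-- The closure `Π₁` of `Π₀`. -/
def closedTriangle (ℓ q : ℕ) (z : ℕ → ℂ) : Set ℂ :=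
  closure (openTriangle ℓ q z)

/-- The polygon with successive vertices `z 0, …, z ℓ` is a basic figure whose basic triangle has
the vertices `z 0`, `z ℓ`, `z q`. Only the values `z 0, …, z ℓ` matter. -/
structure IsBasicFigure (ℓ q : ℕ) (z : ℕ → ℂ) : Prop where
  q_le : q ≤ ℓ
  /-- The triangle is non-degenerate, and `z q` lies to the left of the line from `z 0` to
  `z ℓ`. -/
  orientation : 0 < ((z q - z 0) / (z ℓ - z 0)).im
  /-- Successive segments of the polygon meet only at their common end point. -/
  polygon : ∀ p, 1 ≤ p → p < ℓ →
    segment ℝ (z (p - 1)) (z p) ∩ segment ℝ (z p) (z (p + 1)) = {z p}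
  first_mem : z 1 ∈ segment ℝ (z 0) (z ℓ)
  last_mem : z (ℓ - 1) ∈ segment ℝ (z 0) (z ℓ)
  last_mem' : z (ℓ - 1) ∈ segment ℝ (z 1) (z ℓ)
  vertex_mem : ∀ j ≤ ℓ, z j ∈ {z q} ∪ segment ℝ (z 0) (z ℓ) ∪ openTriangle ℓ q z
  /-- The similitudes `S_j` are contractive, with ratios in `(0, 1)`. -/
  contractive : ∀ j, 1 ≤ j → j ≤ ℓ →
    0 < ‖(z j - z (j - 1)) / (z ℓ - z 0)‖ ∧ ‖(z j - z (j - 1)) / (z ℓ - z 0)‖ < 1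
  disjoint : ∀ i j, 1 ≤ i → i ≤ ℓ → 1 ≤ j → j ≤ ℓ → i ≠ j →
    Disjoint (figureMap ℓ z i '' openTriangle ℓ q z) (figureMap ℓ z j '' openTriangle ℓ q z)
  apex_mem : ∀ j, 1 ≤ j → j ≤ ℓ → figureMap ℓ z j (z q) ∈ closedTriangle ℓ q z
  sides : ∀ j, 1 ≤ j → j ≤ ℓ → j ≠ 1 → j ≠ ℓ → j ≠ q → j ≠ q + 1 →
    figureMap ℓ z j '' closedTriangle ℓ q z ∩
      (segment ℝ (z q) (z 0) ∪ segment ℝ (z q) (z ℓ)) = ∅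

/-- The argument of `w`, taken in `[0, 2π)`. -/
def posArg (w : ℂ) : ℝ := toIcoMod Real.two_pi_pos 0 w.arg

/-- The corner angle `θ_p` at the vertex `z p`, for `1 ≤ p ≤ ℓ - 1`. -/
def cornerAngle (ℓ q : ℕ) (z : ℕ → ℂ) (p : ℕ) : ℝ :=
  posArg ((figureMap ℓ z p (z q) - z p) / (figureMap ℓ z (p + 1) (z q) - z p))

/-- The minimal corner angle `θ_min = min {θ_1, …, θ_{ℓ-1}}`. -/
def minCornerAngle (ℓ q : ℕ) (z : ℕ → ℂ) : ℝ :=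
  sInf (cornerAngle ℓ q z '' Set.Icc 1 (ℓ - 1))

/-- The characteristic angle `ξ = θ_min + min (η_1, η_2)`. -/
def characteristicAngle (ℓ q : ℕ) (z : ℕ → ℂ) : ℝ :=
  minCornerAngle ℓ q z +
    min (posArg ((figureMap ℓ z q (z q) - z q) / (z 0 - z q)))
      (posArg ((z ℓ - z q) / (figureMap ℓ z (q + 1) (z q) - z q)))

/-! ### Regular self-similar arcs -/

/-- `Λ` is the regular self-similar arc generated by the basic figure with vertices
`z 0, …, z ℓ` and apex `z q`. -/
structure IsRegularSelfSimilarArc (ℓ q : ℕ) (z : ℕ → ℂ) (Λ : Set ℂ) : Prop where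
  basicFigure : IsBasicFigure ℓ q z
  /-- `Λ` is the self-similar set of the similitudes `S_1, …, S_ℓ`. -/
  nonempty : Λ.Nonempty
  isCompact : IsCompact Λ
  selfSimilar : Λ = ⋃ j ∈ Set.Icc 1 ℓ, figureMap ℓ z j '' Λ
  /-- `Λ` is an arc. -/
  isArc : Nonempty (unitInterval ≃ₜ Λ)
  characteristicAngle_pos : 0 < characteristicAngle ℓ q z

/-- The `s`-dimensional Hausdorff measure function `x ↦ H^s([x₀, x])` on an arc `E`. -/
def hausdorffMeasureFunction {E : Set ℂ} (h : unitInterval ≃ₜ E) (s : ℝ) (x₀ : ℂ) (x : E) : ℝ :=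
  (μH[s] (subarc h x₀ x)).toReal

end

noncomputable section

open Set Filter Topology
open scoped Convolution

/-! The arc is a snowflake curve. Let `r_j` be the ratios of the similitudes. The polygon passes
through the apex, so it is longer than its base and `∑ r_j > 1`; hence `∑ r_j ^ s = 1` for some `s >
1`. Divide `[0, 1]` into cells of lengths `r_j ^ s` and let `γ : [0, 1] → Λ` conjugate the affine
maps onto the cells to the `S_j`. Then `|γ a - γ b| ^ s` is comparable to `|a - b|`.

Indeed both quantities are multiplied by `r_j ^ s` under passage to the `j`-th cell, so only pairs
in different cells need an estimate (`pair_induction`). For non-adjacent cells it follows from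
compactness, once non-adjacent pieces are known to be disjoint. For adjacent cells both points are
compared with the common vertex: the two small triangles at a vertex with positive corner angle lie
in sectors that meet only there, so the distance of a point of one piece to the vertex is at most a
constant times its distance to the other piece (`exists_separation`). The result is
`exists_biHolder_parametrization`.

Disjointness of non-adjacent pieces (`nonadjacent_disjoint`) uses that `Λ` is an arc. The pieces
correspond to parameter intervals; these do not overlap, because the images of the open triangle are
disjoint and `Λ` has a dense set of points in the open triangle. Consecutive intervals meet, so they
form a chain.

Given `γ`, the rest concerns snowflakes. Points of a subarc have parameters between those of its
ends, which gives the quasi-arc inequality. The measure `H^s(γ [a, b])` is positive and at most a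
constant times `b - a`, so `s` is the dimension, and the measure function is strictly increasing
along the arc and Hölder of exponent `s > 1`. Such a function extends to a `C¹` function with zero
gradient on the arc (`exists_contDiff_extension_of_holder`), by a telescoping sum of mollifications
cut off near the arc. -/

/-! ### Subdivisions of the unit interval -/

/-- The `k`-th node of the subdivision with cell lengths `w 0, w 1, …`. -/
def meshNode (w : ℕ → ℝ) (k : ℕ) : ℝ := ∑ i ∈ Finset.range k, w i

/-- The affine map of `[0, 1]` onto the `j`-th cell of the subdivision. -/
def cellMap (w : ℕ → ℝ) (j : ℕ) (u : ℝ) : ℝ := meshNode w j + w j * u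

/-- The weights `w 0, …, w (n - 1)` are positive and have sum `1`. -/
structure IsUnitMesh (n : ℕ) (w : ℕ → ℝ) : Prop where
  pos : ∀ j < n, 0 < w j
  sum_eq : ∑ i ∈ Finset.range n, w i = 1

namespace IsUnitMesh

variable {n : ℕ} {w : ℕ → ℝ}

lemma meshNode_succ (w : ℕ → ℝ) (k : ℕ) : meshNode w (k + 1) = meshNode w k + w k :=
  Finset.sum_range_succ _ _

lemma meshNode_le (hw : IsUnitMesh n w) {i j : ℕ} (hij : i ≤ j) (hj : j ≤ n) :
    meshNode w i ≤ meshNode w j := by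
  apply Finset.sum_le_sum_of_subset_of_nonneg
  · exact Finset.range_subset_range.2 hij
  · intro k hk _
    exact (hw.pos k ((Finset.mem_range.1 hk).trans_le hj)).le

lemma meshNode_zero (w : ℕ → ℝ) : meshNode w 0 = 0 := by simp [meshNode]

lemma meshNode_last (hw : IsUnitMesh n w) : meshNode w n = 1 := hw.sum_eq

lemma pos_card (hw : IsUnitMesh n w) : 0 < n := by
  rcases Nat.eq_zero_or_pos n with rfl | h
  · have := hw.sum_eq
    simp at this
  · exact h

lemma cellMap_mem (hw : IsUnitMesh n w) {j : ℕ} (hj : j < n) {u : ℝ} (hu : u ∈ Icc (0 : ℝ) 1) :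
    cellMap w j u ∈ Icc (meshNode w j) (meshNode w (j + 1)) := by
  have := hw.pos j hj
  rw [meshNode_succ, cellMap]
  constructor
  · nlinarith [hu.1]
  · nlinarith [hu.2]

lemma cellMap_mem_unit (hw : IsUnitMesh n w) {j : ℕ} (hj : j < n) {u : ℝ}
    (hu : u ∈ Icc (0 : ℝ) 1) : cellMap w j u ∈ Icc (0 : ℝ) 1 := by
  have h := hw.cellMap_mem hj hu
  have h0 := hw.meshNode_le (Nat.zero_le j) hj.le
  have h1 := hw.meshNode_le (Nat.succ_le_of_lt hj) le_rfl
  rw [meshNode_zero] at h0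
  rw [hw.meshNode_last] at h1
  exact ⟨h0.trans h.1, h.2.trans h1⟩

lemma exists_cellMap_eq (hw : IsUnitMesh n w) {t : ℝ} (ht : t ∈ Icc (0 : ℝ) 1) :
    ∃ j < n, ∃ u ∈ Icc (0 : ℝ) 1, cellMap w j u = t := by
  have key : ∀ k, 0 < k → k ≤ n → t ≤ meshNode w k →
      ∃ j < n, ∃ u ∈ Icc (0 : ℝ) 1, cellMap w j u = t := by
    intro k
    induction k with
    | zero => intro h; exact absurd h (lt_irrefl _)
    | succ k ih =>
      intro _ hk htk
      by_cases h : t ≤ meshNode w k ∧ 0 < k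
      · exact ih h.2 (by omega) h.1
      · have hle : meshNode w k ≤ t := by
          rcases Nat.eq_zero_or_pos k with rfl | hk0
          · rw [meshNode_zero]; exact ht.1
          · by_contra hlt
            exact h ⟨(not_le.1 hlt).le, hk0⟩
        have hp := hw.pos k (by omega)
        rw [meshNode_succ] at htk
        refine ⟨k, by omega, (t - meshNode w k) / w k, ⟨?_, ?_⟩, ?_⟩
        · exact div_nonneg (by linarith) hp.le
        · rw [div_le_one hp]; linarith
        · rw [cellMap]; field_simp; ring
  exact key n hw.pos_card le_rfl (hw.meshNode_last ▸ ht.2)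

lemma cellMap_sub (w : ℕ → ℝ) (j : ℕ) (u v : ℝ) :
    cellMap w j u - cellMap w j v = w j * (u - v) := by
  simp only [cellMap]; ring

lemma cellMap_zero (w : ℕ → ℝ) (j : ℕ) : cellMap w j 0 = meshNode w j := by simp [cellMap]

lemma cellMap_one (w : ℕ → ℝ) (j : ℕ) : cellMap w j 1 = meshNode w (j + 1) := by
  simp [cellMap, meshNode_succ]

/-- A point common to two cells is a node of the subdivision. -/
lemma eq_of_cellMap_eq (hw : IsUnitMesh n w) {i j : ℕ} (hij : i < j) (hj : j < n) {u v : ℝ}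
    (hu : u ∈ Icc (0 : ℝ) 1) (hv : v ∈ Icc (0 : ℝ) 1) (h : cellMap w i u = cellMap w j v) :
    j = i + 1 ∧ u = 1 ∧ v = 0 := by
  have hi := hw.pos i (hij.trans hj)
  have hpj := hw.pos j hj
  have h1 := hw.meshNode_le (Nat.succ_le_of_lt hij) hj.le
  have hu' : u = 1 := by
    simp only [cellMap] at h
    rw [Nat.succ_eq_add_one, meshNode_succ] at h1
    nlinarith [hu.2, hv.1]
  have hv' : v = 0 := by
    simp only [cellMap] at h
    rw [Nat.succ_eq_add_one, meshNode_succ] at h1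
    nlinarith [hu.2, hv.1]
  refine ⟨?_, hu', hv'⟩
  by_contra hne
  have hlt : i + 1 < j := by omega
  subst hu' hv'
  rw [cellMap_one, cellMap_zero] at h
  have h2 := hw.meshNode_le (Nat.succ_le_of_lt hlt) hj.le
  have h3 := hw.pos (i + 1) (hlt.trans hj)
  rw [Nat.succ_eq_add_one, meshNode_succ] at h2
  linarith

lemma cellMap_eq_zero (hw : IsUnitMesh n w) {j : ℕ} (hj : j < n) {u : ℝ}
    (hu : u ∈ Icc (0 : ℝ) 1) (h : cellMap w j u = 0) : j = 0 ∧ u = 0 := by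
  rcases Nat.eq_zero_or_pos j with rfl | hpos
  · refine ⟨rfl, ?_⟩
    have := hw.pos 0 hj
    rw [cellMap, meshNode_zero, zero_add] at h
    exact (mul_eq_zero.1 h).resolve_left this.ne'
  -- A point shared with a later cell would have parameter 1 in cell 0, but here that parameter is
  -- 0.
  · have h0 : cellMap w 0 0 = cellMap w j u := by rw [h, cellMap_zero, meshNode_zero]
    have := (hw.eq_of_cellMap_eq hpos hj ⟨le_rfl, zero_le_one⟩ hu h0).2.1
    norm_num at this

lemma cellMap_eq_one (hw : IsUnitMesh n w) {j : ℕ} (hj : j < n) {u : ℝ}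
    (hu : u ∈ Icc (0 : ℝ) 1) (h : cellMap w j u = 1) : j + 1 = n ∧ u = 1 := by
  have hn := hw.pos_card
  have h1 : cellMap w (n - 1) 1 = 1 := by
    rw [cellMap_one, Nat.sub_add_cancel hn, hw.meshNode_last]
  rcases (Nat.le_sub_one_of_lt hj).lt_or_eq with hlt | heq
  · have := (hw.eq_of_cellMap_eq hlt (by omega) hu ⟨zero_le_one, le_rfl⟩ (h.trans h1.symm)).2.2
    norm_num at this
  · refine ⟨by omega, ?_⟩
    have := hw.pos j hj
    rw [← heq] at h1
    have h2 := cellMap_sub w j 1 u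
    rw [h1, h, sub_self] at h2
    have := (mul_eq_zero.1 h2.symm).resolve_left this.ne'
    linarith

lemma weight_lt_one (hw : IsUnitMesh n w) (hn : 1 < n) {j : ℕ} (hj : j < n) : w j < 1 := by
  rw [← hw.sum_eq]
  obtain ⟨k, hk, hkj⟩ : ∃ k < n, k ≠ j := by
    by_cases h : j = 0
    · exact ⟨1, hn, by omega⟩
    · exact ⟨0, by omega, fun h' => h h'.symm⟩
  exact Finset.single_lt_sum hkj (Finset.mem_range.2 hj) (Finset.mem_range.2 hk) (hw.pos k hk)
    (fun i hi _ => (hw.pos i (Finset.mem_range.1 hi)).le)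

/-- A property of ordered pairs holds on `[0, 1]` if it is transported by the cell maps and holds
for pairs in different cells. -/
lemma pair_induction (hw : IsUnitMesh n w) (hn : 1 < n) {Q : ℝ → ℝ → Prop}
    (hdiag : ∀ a ∈ Icc (0 : ℝ) 1, Q a a)
    (hcell : ∀ j < n, ∀ a ∈ Icc (0 : ℝ) 1, ∀ b ∈ Icc (0 : ℝ) 1, Q a b →
      Q (cellMap w j a) (cellMap w j b))
    (hdiff : ∀ i j, i < j → j < n → ∀ a ∈ Icc (0 : ℝ) 1, ∀ b ∈ Icc (0 : ℝ) 1,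
      Q (cellMap w i a) (cellMap w j b)) :
    ∀ a ∈ Icc (0 : ℝ) 1, ∀ b ∈ Icc (0 : ℝ) 1, a ≤ b → Q a b := by
  obtain ⟨ρ, hρ0, hρ1, hρ⟩ : ∃ ρ : ℝ, 0 ≤ ρ ∧ ρ < 1 ∧ ∀ j < n, w j ≤ ρ := by
    have hne : (Finset.range n).Nonempty := ⟨0, Finset.mem_range.2 (by omega)⟩
    refine ⟨(Finset.range n).sup' hne w, ?_, ?_, ?_⟩
    · exact (hw.pos 0 (by omega)).le.trans (Finset.le_sup' w (Finset.mem_range.2 (by omega)))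
    · rw [Finset.sup'_lt_iff]
      exact fun j hj => hw.weight_lt_one hn (Finset.mem_range.1 hj)
    · exact fun j hj => Finset.le_sup' w (Finset.mem_range.2 hj)
  -- Passing from two points of one cell to their cell parameters multiplies their distance by at
  -- least `1 / ρ`. Distances in `[0, 1]` are at most 1, so the points part after finitely many
  -- steps.
  have key : ∀ k : ℕ, ∀ a ∈ Icc (0 : ℝ) 1, ∀ b ∈ Icc (0 : ℝ) 1, a ≤ b → ρ ^ k < b - a → Q a b := by
    intro k
    induction k with
    | zero =>
      intro a ha b hb _ h
      rw [pow_zero] at h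
      linarith [ha.1, hb.2]
    | succ k ih =>
      intro a ha b hb hab h
      obtain ⟨i, hi, u, hu, rfl⟩ := hw.exists_cellMap_eq ha
      obtain ⟨j, hj, v, hv, rfl⟩ := hw.exists_cellMap_eq hb
      rcases lt_trichotomy i j with hij | rfl | hij
      · exact hdiff i j hij hj u hu v hv
      · have hp := hw.pos i hi
        rw [cellMap_sub, pow_succ] at h
        have hk : 0 ≤ ρ ^ k := pow_nonneg hρ0 k
        have huv : 0 < v - u := by
          by_contra hneg
          nlinarith [mul_nonneg hk hρ0]
        refine hcell i hi u hu v hv (ih u hu v hv (by linarith) ?_)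
        have hle := hρ i hi
        have hρpos : 0 < ρ := hp.trans_le hle
        have : w i * (v - u) ≤ ρ * (v - u) := mul_le_mul_of_nonneg_right hle huv.le
        nlinarith
      -- The smaller number lies in the later cell, so both numbers are the same node.
      · have h1 := hw.cellMap_mem hi hu
        have h2 := hw.cellMap_mem hj hv
        have h3 := hw.meshNode_le (Nat.succ_le_of_lt hij) hi.le
        have : cellMap w i u = cellMap w j v := le_antisymm hab (h2.2.trans (h3.trans h1.1))
        rw [this]
        exact hdiag _ (hw.cellMap_mem_unit hj hv)
  intro a ha b hb hab
  rcases hab.eq_or_lt with rfl | hlt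
  · exact hdiag a ha
  · obtain ⟨k, hk⟩ := exists_pow_lt_of_lt_one (sub_pos.2 hlt) hρ1
    exact key k a ha b hb hab hk

end IsUnitMesh

/-! ### Chains of similarities -/

/-- The compact set `Λ` is the union of its images under the similarities `T 0, …, T (n - 1)`,
which map the base points `p 0, p n` to successive points of the chain `p 0, …, p n`. -/
structure IsSimilarityChain {X : Type*} [MetricSpace X] (n : ℕ) (p : ℕ → X) (T : ℕ → X → X)
    (r : ℕ → ℝ) (Λ : Set X) : Prop where
  ratio_pos : ∀ j < n, 0 < r j
  ratio_lt_one : ∀ j < n, r j < 1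
  dist_map : ∀ j < n, ∀ x y, dist (T j x) (T j y) = r j * dist x y
  map_first : ∀ j < n, T j (p 0) = p j
  map_last : ∀ j < n, T j (p n) = p (j + 1)
  isCompact : IsCompact Λ
  first_mem : p 0 ∈ Λ
  mapsTo : ∀ j < n, ∀ x ∈ Λ, T j x ∈ Λ
  exists_preimage : ∀ x ∈ Λ, ∃ j < n, ∃ y ∈ Λ, T j y = x

namespace IsSimilarityChain

variable {X : Type*} [MetricSpace X] {n : ℕ} {p : ℕ → X} {T : ℕ → X → X} {r : ℕ → ℝ} {Λ : Set X}

lemma pos_card (h : IsSimilarityChain n p T r Λ) : 0 < n := by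
  obtain ⟨j, hj, -⟩ := h.exists_preimage _ h.first_mem
  omega

lemma continuous_map (h : IsSimilarityChain n p T r Λ) {j : ℕ} (hj : j < n) :
    Continuous (T j) := by
  refine (LipschitzWith.of_dist_le_mul (K := ⟨r j, (h.ratio_pos j hj).le⟩) fun x y => ?_).continuous
  exact (h.dist_map j hj x y).le

lemma exists_ratio_bound (h : IsSimilarityChain n p T r Λ) :
    ∃ ρ : ℝ, 0 ≤ ρ ∧ ρ < 1 ∧ ∀ j < n, r j ≤ ρ := by
  have hn := h.pos_card
  have hne : (Finset.range n).Nonempty := ⟨0, Finset.mem_range.2 hn⟩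
  refine ⟨(Finset.range n).sup' hne r, ?_, ?_, ?_⟩
  · exact (h.ratio_pos 0 hn).le.trans (Finset.le_sup' r (Finset.mem_range.2 hn))
  · rw [Finset.sup'_lt_iff]
    exact fun j hj => h.ratio_lt_one j (Finset.mem_range.1 hj)
  · exact fun j hj => Finset.le_sup' r (Finset.mem_range.2 hj)

/-- Non-empty subsets of the attractor that are mapped to themselves are dense in it. -/
lemma subset_closure (h : IsSimilarityChain n p T r Λ) {A : Set X} (hA : A ⊆ Λ)
    (hne : A.Nonempty) (hmaps : ∀ j < n, ∀ x ∈ A, T j x ∈ A) : Λ ⊆ closure A := by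
  obtain ⟨ρ, hρ0, hρ1, hρ⟩ := h.exists_ratio_bound
  obtain ⟨a, ha⟩ := hne
  -- A point of `Λ` is the image of a point of `Λ` under a word of length `k`; the same word sends
  -- `a` to a point of `A` within `ρ ^ k * diam Λ` of it.
  have key : ∀ k : ℕ, ∀ x ∈ Λ, ∃ y ∈ A, dist x y ≤ ρ ^ k * Metric.diam Λ := by
    intro k
    induction k with
    | zero =>
      intro x hx
      exact ⟨a, ha, by simpa using Metric.dist_le_diam_of_mem h.isCompact.isBounded hx (hA ha)⟩
    | succ k ih =>
      intro x hx
      obtain ⟨j, hj, y, hy, rfl⟩ := h.exists_preimage x hx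
      obtain ⟨b, hb, hd⟩ := ih y hy
      refine ⟨T j b, hmaps j hj b hb, ?_⟩
      rw [h.dist_map j hj, pow_succ', mul_assoc]
      exact mul_le_mul (hρ j hj) hd dist_nonneg hρ0
  intro x hx
  rw [Metric.mem_closure_iff]
  intro ε hε
  have hlim : Tendsto (fun k : ℕ => ρ ^ k * Metric.diam Λ) atTop (𝓝 0) := by
    simpa using (tendsto_pow_atTop_nhds_zero_of_lt_one hρ0 hρ1).mul_const (Metric.diam Λ)
  obtain ⟨k, hk⟩ := (hlim.eventually (gt_mem_nhds hε)).exists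
  obtain ⟨y, hy, hd⟩ := key k x hx
  exact ⟨y, hy, hd.trans_lt hk⟩

lemma eq_of_fixed (h : IsSimilarityChain n p T r Λ) {j : ℕ} (hj : j < n) {x y : X}
    (hx : T j x = x) (hy : T j y = y) : x = y := by
  have h1 := h.dist_map j hj x y
  rw [hx, hy] at h1
  have h2 := h.ratio_lt_one j hj
  have h3 : dist x y = 0 := by nlinarith [dist_nonneg (x := x) (y := y)]
  exact dist_eq_zero.1 h3

/-- The parametrization of the attractor that conjugates the cell maps of a subdivision to the
similarities. -/
lemma exists_parametrization [CompleteSpace X] (h : IsSimilarityChain n p T r Λ) {w : ℕ → ℝ}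
    (hw : IsUnitMesh n w) :
    ∃ γ : ℝ → X, γ 0 = p 0 ∧ γ 1 = p n ∧ (∀ t ∈ Icc (0 : ℝ) 1, γ t ∈ Λ) ∧
      ∀ j < n, ∀ u ∈ Icc (0 : ℝ) 1, γ (cellMap w j u) = T j (γ u) := by
  obtain ⟨ρ, hρ0, hρ1, hρ⟩ := h.exists_ratio_bound
  have hn := h.pos_card
  -- Choosing a cell `J t` and a cell parameter `σ t` gives each `t` an address `J t, J (σ t), …`;
  -- the values outside `[0, 1]` are irrelevant.
  have hsel : ∀ t : ℝ, ∃ j : ℕ, ∃ u : ℝ, t ∈ Icc (0 : ℝ) 1 →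
      j < n ∧ u ∈ Icc (0 : ℝ) 1 ∧ cellMap w j u = t := by
    intro t
    by_cases ht : t ∈ Icc (0 : ℝ) 1
    · obtain ⟨j, hj, u, hu, e⟩ := hw.exists_cellMap_eq ht
      exact ⟨j, u, fun _ => ⟨hj, hu, e⟩⟩
    · exact ⟨0, 0, fun h => absurd h ht⟩
  choose J σ hJ using hsel
  -- `g k t` applies the first `k` maps of the address of `t` to `p 0`; `γ t` will be its limit.
  let g : ℕ → ℝ → X := fun k => Nat.rec (fun _ => p 0) (fun _ f t => T (J t) (f (σ t))) k
  have g_succ : ∀ k t, g (k + 1) t = T (J t) (g k (σ t)) := fun _ _ => rfl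
  have g_mem : ∀ k, ∀ t ∈ Icc (0 : ℝ) 1, g k t ∈ Λ := by
    intro k
    induction k with
    | zero => exact fun _ _ => h.first_mem
    | succ k ih =>
      intro t ht
      obtain ⟨h1, h2, -⟩ := hJ t ht
      rw [g_succ]
      exact h.mapsTo _ h1 _ (ih _ h2)
  have g_dist : ∀ k, ∀ t ∈ Icc (0 : ℝ) 1, dist (g k t) (g (k + 1) t) ≤ Metric.diam Λ * ρ ^ k := by
    intro k
    induction k with
    | zero =>
      intro t ht
      simpa using Metric.dist_le_diam_of_mem h.isCompact.isBounded (g_mem 0 t ht) (g_mem 1 t ht)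
    | succ k ih =>
      intro t ht
      obtain ⟨h1, h2, -⟩ := hJ t ht
      rw [g_succ, g_succ (k + 1), h.dist_map _ h1, pow_succ', mul_left_comm]
      exact mul_le_mul (hρ _ h1) (ih _ h2) dist_nonneg hρ0
  have hlim : ∀ t : ℝ, ∃ x : X, t ∈ Icc (0 : ℝ) 1 → Tendsto (fun k => g k t) atTop (𝓝 x) := by
    intro t
    by_cases ht : t ∈ Icc (0 : ℝ) 1
    · obtain ⟨x, hx⟩ := cauchySeq_tendsto_of_complete
        (cauchySeq_of_le_geometric ρ (Metric.diam Λ) hρ1 fun k => g_dist k t ht)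
      exact ⟨x, fun _ => hx⟩
    · exact ⟨p 0, fun h => absurd h ht⟩
  choose γ hγ using hlim
  have heq : ∀ t ∈ Icc (0 : ℝ) 1, γ t = T (J t) (γ (σ t)) := by
    intro t ht
    obtain ⟨h1, h2, -⟩ := hJ t ht
    refine tendsto_nhds_unique ((tendsto_add_atTop_iff_nat 1).2 (hγ t ht)) ?_
    exact ((h.continuous_map h1).tendsto _).comp (hγ _ h2)
  have h01 : (0 : ℝ) ∈ Icc (0 : ℝ) 1 := ⟨le_rfl, zero_le_one⟩
  have h11 : (1 : ℝ) ∈ Icc (0 : ℝ) 1 := ⟨zero_le_one, le_rfl⟩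
  -- The address of 0 uses only the first cell, so `γ 0` is the fixed point of `T 0`. Likewise `γ 1`
  -- is the fixed point of the last map.
  have hγ0 : γ 0 = p 0 := by
    obtain ⟨h1, h2, h3⟩ := hJ 0 h01
    obtain ⟨e1, e2⟩ := hw.cellMap_eq_zero h1 h2 h3
    have := heq 0 h01
    rw [e1, e2] at this
    exact h.eq_of_fixed hn this.symm (h.map_first 0 hn)
  have hγ1 : γ 1 = p n := by
    obtain ⟨h1, h2, h3⟩ := hJ 1 h11
    obtain ⟨e1, e2⟩ := hw.cellMap_eq_one h1 h2 h3
    have := heq 1 h11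
    rw [e2] at this
    exact h.eq_of_fixed h1 this.symm ((h.map_last _ h1).trans (by rw [e1]))
  refine ⟨γ, hγ0, hγ1, ?_, ?_⟩
  · intro t ht
    exact h.isCompact.isClosed.mem_of_tendsto (hγ t ht) (Eventually.of_forall fun k => g_mem k t ht)
  · intro j hj u hu
    have ht := hw.cellMap_mem_unit hj hu
    obtain ⟨t, hte⟩ : ∃ t, t = cellMap w j u := ⟨_, rfl⟩
    rw [← hte] at ht ⊢
    obtain ⟨h1, h2, h3⟩ := hJ _ ht
    rw [heq _ ht]
    -- At a node the chosen cell may be the neighbour of cell `j`. Both choices give the same value,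
    -- because adjacent maps send the last and the first base point to a common vertex.
    rcases lt_trichotomy (J t) j with hlt | he | hlt
    · obtain ⟨e1, e2, e3⟩ := hw.eq_of_cellMap_eq hlt hj h2 hu (h3.trans hte)
      rw [e2, e3, hγ0, hγ1, h.map_last _ h1, h.map_first j hj, ← e1]
    · rw [he] at h3 ⊢
      have h4 := IsUnitMesh.cellMap_sub w j (σ t) u
      rw [h3, hte, sub_self] at h4
      have := (mul_eq_zero.1 h4.symm).resolve_left (hw.pos j hj).ne'
      rw [hte, sub_eq_zero.1 this]
    · obtain ⟨e1, e2, e3⟩ := hw.eq_of_cellMap_eq hlt h1 hu h2 (hte.symm.trans h3.symm)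
      rw [e2, e3, hγ0, hγ1, h.map_last _ hj, h.map_first _ h1, ← e1]

/-- The exponent `s` with `∑ r j ^ s = 1` exceeds `1` if `∑ r j > 1`. -/
lemma exists_similarity_dimension (h : IsSimilarityChain n p T r Λ)
    (hsum : 1 < ∑ i ∈ Finset.range n, r i) :
    ∃ s : ℝ, 1 < s ∧ IsUnitMesh n (fun j => r j ^ s) := by
  set φ : ℝ → ℝ := fun s => ∑ i ∈ Finset.range n, r i ^ s with hφ
  have hcont : Continuous φ := by
    refine continuous_finsetSum _ fun i hi => ?_
    exact Real.continuous_const_rpow (h.ratio_pos i (Finset.mem_range.1 hi)).ne'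
  have hlim : Tendsto φ atTop (𝓝 0) := by
    have : Tendsto φ atTop (𝓝 (∑ i ∈ Finset.range n, (0 : ℝ))) := by
      refine tendsto_finsetSum _ fun i hi => ?_
      have hi' := Finset.mem_range.1 hi
      exact tendsto_rpow_atTop_of_base_lt_one _ (by linarith [h.ratio_pos i hi'])
        (h.ratio_lt_one i hi')
    simpa using this
  obtain ⟨M, hM1, hM⟩ := ((eventually_ge_atTop (1 : ℝ)).and
    (hlim.eventually (gt_mem_nhds zero_lt_one))).exists
  have h1 : 1 < φ 1 := by simpa [hφ] using hsum
  obtain ⟨s, hs, he⟩ := intermediate_value_Icc' hM1 hcont.continuousOn ⟨hM.le, h1.le⟩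
  refine ⟨s, lt_of_le_of_ne hs.1 ?_, fun j hj => Real.rpow_pos_of_pos (h.ratio_pos j hj) s, he⟩
  rintro rfl
  exact h1.ne' he

/-- If non-adjacent pieces of the attractor are disjoint and adjacent ones are separated by
cones, then the attractor has a parametrization that distorts distances like a power. -/
theorem exists_biHolder_parametrization [CompleteSpace X] (h : IsSimilarityChain n p T r Λ)
    (hne : p 0 ≠ p n) (hsum : 1 < ∑ i ∈ Finset.range n, r i)
    (hdisj : ∀ i j, i + 1 < j → j < n → ∀ x ∈ Λ, ∀ y ∈ Λ, T i x ≠ T j y) {K : ℝ} (hK0 : 0 ≤ K)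
    (hK : ∀ i, i + 1 < n → ∀ x ∈ Λ, ∀ y ∈ Λ,
      dist (T i x) (p (i + 1)) ≤ K * dist (T i x) (T (i + 1) y)) :
    ∃ s c C : ℝ, ∃ γ : ℝ → X, 1 < s ∧ 0 < c ∧ 0 < C ∧ γ 0 = p 0 ∧ γ '' Icc 0 1 = Λ ∧
      ∀ a ∈ Icc (0 : ℝ) 1, ∀ b ∈ Icc (0 : ℝ) 1,
        c * |a - b| ≤ dist (γ a) (γ b) ^ s ∧ dist (γ a) (γ b) ^ s ≤ C * |a - b| := by
  obtain ⟨s, hs, hw⟩ := h.exists_similarity_dimension hsum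
  obtain ⟨γ, hγ0, hγ1, hγΛ, hγ⟩ := h.exists_parametrization hw
  -- With these weights `dist ^ s` and the parameter distance scale by the same factor on each cell.
  set w : ℕ → ℝ := fun j => r j ^ s with hwdef
  have hs0 : 0 < s := by linarith
  have hn : 1 < n := by
    by_contra hn
    have hn1 : n = 1 := by have := h.pos_card; omega
    rw [hn1, Finset.sum_range_one] at hsum
    linarith [h.ratio_lt_one 0 h.pos_card]
  have hstep : ∀ j < n, p j ≠ p (j + 1) := by
    intro j hj he
    have h1 := h.dist_map j hj (p 0) (p n)
    rw [h.map_first j hj, h.map_last j hj, he, dist_self] at h1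
    rcases mul_eq_zero.1 h1.symm with h2 | h2
    · exact (h.ratio_pos j hj).ne' h2
    · exact hne (dist_eq_zero.1 h2)
  have h01 : (0 : ℝ) ∈ Icc (0 : ℝ) 1 := ⟨le_rfl, zero_le_one⟩
  have h11 : (1 : ℝ) ∈ Icc (0 : ℝ) 1 := ⟨zero_le_one, le_rfl⟩
  have hlast : p n ∈ Λ := hγ1 ▸ hγΛ 1 h11
  have hscale : ∀ j < n, ∀ a ∈ Icc (0 : ℝ) 1, ∀ b ∈ Icc (0 : ℝ) 1,
      dist (γ (cellMap w j a)) (γ (cellMap w j b)) ^ s = w j * dist (γ a) (γ b) ^ s := by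
    intro j hj a ha b hb
    rw [hγ j hj a ha, hγ j hj b hb, h.dist_map j hj,
      Real.mul_rpow (h.ratio_pos j hj).le dist_nonneg]
  have hscale' : ∀ j < n, ∀ a b : ℝ, |cellMap w j a - cellMap w j b| = w j * |a - b| := by
    intro j hj a b
    rw [IsUnitMesh.cellMap_sub, abs_mul, abs_of_pos (hw.pos j hj)]
  -- the two-sided estimate is transported by the cell maps
  have htrans : ∀ c C : ℝ, ∀ j < n, ∀ a ∈ Icc (0 : ℝ) 1, ∀ b ∈ Icc (0 : ℝ) 1,
      (c * |a - b| ≤ dist (γ a) (γ b) ^ s ∧ dist (γ a) (γ b) ^ s ≤ C * |a - b|) →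
      (c * |cellMap w j a - cellMap w j b| ≤ dist (γ (cellMap w j a)) (γ (cellMap w j b)) ^ s ∧
        dist (γ (cellMap w j a)) (γ (cellMap w j b)) ^ s ≤
          C * |cellMap w j a - cellMap w j b|) := by
    intro c C j hj a ha b hb ⟨h1, h2⟩
    rw [hscale j hj a ha b hb, hscale' j hj, mul_left_comm, mul_left_comm C]
    have := (hw.pos j hj).le
    exact ⟨mul_le_mul_of_nonneg_left h1 this, mul_le_mul_of_nonneg_left h2 this⟩
  obtain ⟨m, hm0, hm⟩ : ∃ m : ℝ, 0 < m ∧ ∀ j < n, m ≤ w j := by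
    have hne : (Finset.range n).Nonempty := ⟨0, Finset.mem_range.2 (by omega)⟩
    refine ⟨(Finset.range n).inf' hne w, ?_, fun j hj => Finset.inf'_le _ (Finset.mem_range.2 hj)⟩
    rw [Finset.lt_inf'_iff]
    exact fun j hj => hw.pos j (Finset.mem_range.1 hj)
  set D : ℝ := Metric.diam Λ + 1 with hD
  have hD0 : 0 < D := by have := Metric.diam_nonneg (s := Λ); linarith
  have hDle : ∀ a ∈ Icc (0 : ℝ) 1, ∀ b ∈ Icc (0 : ℝ) 1, dist (γ a) (γ b) ≤ D := by
    intro a ha b hb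
    have := Metric.dist_le_diam_of_mem h.isCompact.isBounded (hγΛ a ha) (hγΛ b hb)
    linarith
  -- a pair of points at distance at least `δ` with parameters at distance at least `m`
  have hfar : ∀ δ : ℝ, 0 < δ → ∀ a ∈ Icc (0 : ℝ) 1, ∀ b ∈ Icc (0 : ℝ) 1, m ≤ |a - b| →
      δ ≤ dist (γ a) (γ b) → (δ ^ s * |a - b| ≤ dist (γ a) (γ b) ^ s ∧
        dist (γ a) (γ b) ^ s ≤ D ^ s / m * |a - b|) := by
    intro δ hδ a ha b hb hmab hδab
    constructor
    · have h1 : |a - b| ≤ 1 := by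
        rw [abs_le]; constructor <;> linarith [ha.1, ha.2, hb.1, hb.2]
      calc δ ^ s * |a - b| ≤ δ ^ s * 1 :=
            mul_le_mul_of_nonneg_left h1 (Real.rpow_nonneg hδ.le _)
        _ ≤ dist (γ a) (γ b) ^ s := by
            rw [mul_one]; exact Real.rpow_le_rpow hδ.le hδab hs0.le
    · calc dist (γ a) (γ b) ^ s ≤ D ^ s := Real.rpow_le_rpow dist_nonneg (hDle a ha b hb) hs0.le
        _ = D ^ s / m * m := by field_simp
        _ ≤ D ^ s / m * |a - b| := by
            apply mul_le_mul_of_nonneg_left hmab; positivity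
  have hpiece : ∀ j < n, IsCompact (T j '' Λ) := fun j hj =>
    h.isCompact.image (h.continuous_map hj)
  -- the first point is far from the later pieces
  obtain ⟨δ₀, hδ₀, hfirst⟩ : ∃ δ : ℝ, 0 < δ ∧ ∀ j, 0 < j → j < n → ∀ y ∈ Λ,
      δ ≤ dist (p 0) (T j y) := by
    have hc : IsCompact (⋃ j ∈ Finset.Ioo 0 n, T j '' Λ) :=
      (Finset.Ioo 0 n).isCompact_biUnion fun j hj => hpiece j (Finset.mem_Ioo.1 hj).2
    obtain ⟨δ, hδ, hle⟩ := hc.exists_forall_le' (f := fun y => dist (p 0) y) (a := 0)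
      (by fun_prop) (by
        intro y hy
        simp only [mem_iUnion, Finset.mem_Ioo] at hy
        obtain ⟨j, ⟨hj0, hj⟩, x, hx, rfl⟩ := hy
        rw [dist_pos]
        intro he
        -- For the second piece the cone bound at `p 1` would give `p 0 = p 1`; the later pieces are
        -- disjoint from the first one.
        rcases (Nat.succ_le_of_lt hj0).eq_or_lt with e | hlt
        · have := hK 0 hn (p 0) h.first_mem x hx
          rw [h.map_first 0 (by omega), zero_add, show (1 : ℕ) = j from e, ← he, dist_self,
            mul_zero] at this
          exact hstep 0 (by omega) ((dist_le_zero.1 this).trans (by rw [zero_add, ← e]))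
        · exact hdisj 0 j hlt hj (p 0) h.first_mem x hx ((h.map_first 0 (by omega)).trans he))
    refine ⟨δ, hδ, fun j hj0 hj y hy => hle _ ?_⟩
    simp only [mem_iUnion, Finset.mem_Ioo]
    exact ⟨j, ⟨hj0, hj⟩, mem_image_of_mem _ hy⟩
  -- the last point is far from the earlier pieces
  obtain ⟨δ₁, hδ₁, hend⟩ : ∃ δ : ℝ, 0 < δ ∧ ∀ j, j + 1 < n → ∀ y ∈ Λ,
      δ ≤ dist (T j y) (p n) := by
    have hc : IsCompact (⋃ j ∈ Finset.range (n - 1), T j '' Λ) :=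
      (Finset.range (n - 1)).isCompact_biUnion fun j hj =>
        hpiece j (by have := Finset.mem_range.1 hj; omega)
    obtain ⟨δ, hδ, hle⟩ := hc.exists_forall_le' (f := fun y => dist y (p n)) (a := 0)
      (by fun_prop) (by
        intro y hy
        simp only [mem_iUnion, Finset.mem_range] at hy
        obtain ⟨j, hj, x, hx, rfl⟩ := hy
        rw [dist_pos]
        intro he
        have hmap : T (n - 1) (p n) = p n := by
          rw [h.map_last _ (by omega), Nat.sub_add_cancel (by omega)]
        rcases (show j + 1 ≤ n - 1 by omega).eq_or_lt with e | hlt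
        · have := hK j (by omega) x hx (p n) hlast
          rw [e, hmap, he, dist_self, mul_zero] at this
          apply hstep (n - 1) (by omega)
          rw [Nat.sub_add_cancel (by omega)]
          exact (dist_le_zero.1 this).symm
        · exact hdisj j (n - 1) hlt (by omega) x hx (p n) hlast (he.trans hmap.symm))
    refine ⟨δ, hδ, fun j hj y hy => hle _ ?_⟩
    simp only [mem_iUnion, Finset.mem_range]
    exact ⟨j, by omega, mem_image_of_mem _ hy⟩
  -- non-adjacent pieces are far from each other
  obtain ⟨δ₂, hδ₂, hnonadj⟩ : ∃ δ : ℝ, 0 < δ ∧ ∀ i j, i + 1 < j → j < n → ∀ x ∈ Λ, ∀ y ∈ Λ,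
      δ ≤ dist (T i x) (T j y) := by
    have hc : IsCompact (⋃ ij ∈ (Finset.range n ×ˢ Finset.range n).filter
        (fun ij : ℕ × ℕ => ij.1 + 1 < ij.2), (T ij.1 '' Λ) ×ˢ (T ij.2 '' Λ)) := by
      refine Finset.isCompact_biUnion _ fun ij hij => ?_
      simp only [Finset.mem_filter, Finset.mem_product, Finset.mem_range] at hij
      exact (hpiece _ hij.1.1).prod (hpiece _ hij.1.2)
    obtain ⟨δ, hδ, hle⟩ := hc.exists_forall_le' (f := fun y : X × X => dist y.1 y.2) (a := 0)
      (by fun_prop) (by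
        rintro ⟨_, _⟩ hy
        simp only [mem_iUnion, Finset.mem_filter, Finset.mem_product, Finset.mem_range] at hy
        obtain ⟨⟨i, j⟩, ⟨⟨-, hj⟩, hij⟩, ⟨x, hx, rfl⟩, ⟨y, hy, rfl⟩⟩ := hy
        exact dist_pos.2 (hdisj i j hij hj x hx y hy))
    refine ⟨δ, hδ, fun i j hij hj x hx y hy => hle (T i x, T j y) ?_⟩
    simp only [mem_iUnion, Finset.mem_filter, Finset.mem_product, Finset.mem_range]
    exact ⟨(i, j), ⟨⟨by omega, hj⟩, hij⟩, mem_image_of_mem _ hx, mem_image_of_mem _ hy⟩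
  -- estimates at the two end points
  have hE0 : ∀ u ∈ Icc (0 : ℝ) 1, δ₀ ^ s * |0 - u| ≤ dist (γ 0) (γ u) ^ s ∧
      dist (γ 0) (γ u) ^ s ≤ D ^ s / m * |0 - u| := by
    intro u hu
    -- The condition `a = 0` is inherited by cell parameters, so the induction stays on pairs with
    -- first entry 0. A second point in a later cell lies beyond the whole first cell, at parameter
    -- distance at least `m`.
    refine hw.pair_induction hn (Q := fun a b => a = 0 →
      (δ₀ ^ s * |a - b| ≤ dist (γ a) (γ b) ^ s ∧ dist (γ a) (γ b) ^ s ≤ D ^ s / m * |a - b|))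
      ?_ ?_ ?_ 0 h01 u hu hu.1 rfl
    · intro a _ _
      simp [Real.zero_rpow hs0.ne']
    · intro j hj a ha b hb hab he
      exact htrans _ _ j hj a ha b hb (hab (hw.cellMap_eq_zero hj ha he).2)
    · intro i j hij hj a ha b hb he
      have hb' := hw.cellMap_mem_unit hj hb
      rw [he]
      refine hfar δ₀ hδ₀ 0 h01 _ hb' ?_ ?_
      · have h1 := (hw.cellMap_mem hj hb).1
        have h2 := hw.meshNode_le (show 1 ≤ j by omega) hj.le
        have h3 := hm 0 (by omega)
        rw [← zero_add 1, IsUnitMesh.meshNode_succ, IsUnitMesh.meshNode_zero] at h2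
        rw [zero_sub, abs_neg]
        exact le_trans (by linarith) (le_abs_self _)
      · rw [hγ0, hγ j hj b hb]
        exact hfirst j (by omega) hj _ (hγΛ b hb)
  have hE1 : ∀ u ∈ Icc (0 : ℝ) 1, δ₁ ^ s * |u - 1| ≤ dist (γ u) (γ 1) ^ s ∧
      dist (γ u) (γ 1) ^ s ≤ D ^ s / m * |u - 1| := by
    intro u hu
    refine hw.pair_induction hn (Q := fun a b => b = 1 →
      (δ₁ ^ s * |a - b| ≤ dist (γ a) (γ b) ^ s ∧ dist (γ a) (γ b) ^ s ≤ D ^ s / m * |a - b|))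
      ?_ ?_ ?_ u hu 1 h11 hu.2 rfl
    · intro a _ _
      simp [Real.zero_rpow hs0.ne']
    · intro j hj a ha b hb hab he
      exact htrans _ _ j hj a ha b hb (hab (hw.cellMap_eq_one hj hb he).2)
    · intro i j hij hj a ha b hb he
      have ha' := hw.cellMap_mem_unit (hij.trans hj) ha
      rw [he]
      refine hfar δ₁ hδ₁ _ ha' 1 h11 ?_ ?_
      · have h1 := (hw.cellMap_mem (hij.trans hj) ha).2
        have h2 := hw.meshNode_le (show i + 1 ≤ n - 1 by omega) (by omega)
        have h3 := hm (n - 1) (by omega)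
        have h4 := hw.meshNode_last
        rw [← Nat.sub_add_cancel hn.le, IsUnitMesh.meshNode_succ] at h4
        rw [abs_sub_comm]
        exact le_trans (by linarith) (le_abs_self _)
      · rw [hγ1, hγ i (hij.trans hj) a ha]
        exact hend i (by omega) _ (hγΛ a ha)
  set c₀ : ℝ := min (δ₀ ^ s) (δ₁ ^ s) with hc₀
  set C₀ : ℝ := D ^ s / m with hC₀
  have hc₀pos : 0 < c₀ := lt_min (Real.rpow_pos_of_pos hδ₀ s) (Real.rpow_pos_of_pos hδ₁ s)
  have hC₀pos : 0 < C₀ := div_pos (Real.rpow_pos_of_pos hD0 s) hm0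
  -- pairs in adjacent cells
  have hadj : ∀ i, i + 1 < n → ∀ a ∈ Icc (0 : ℝ) 1, ∀ b ∈ Icc (0 : ℝ) 1,
      c₀ / (2 * (K + 1) ^ s) * |cellMap w i a - cellMap w (i + 1) b| ≤
          dist (γ (cellMap w i a)) (γ (cellMap w (i + 1) b)) ^ s ∧
        dist (γ (cellMap w i a)) (γ (cellMap w (i + 1) b)) ^ s ≤
          2 ^ s * C₀ * |cellMap w i a - cellMap w (i + 1) b| := by
    intro i hi a ha b hb
    have hi' : i < n := by omega
    have e0 : cellMap w i 1 = meshNode w (i + 1) := IsUnitMesh.cellMap_one w i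
    have e1 : cellMap w (i + 1) 0 = meshNode w (i + 1) := IsUnitMesh.cellMap_zero w (i + 1)
    have g0 : γ (meshNode w (i + 1)) = p (i + 1) := by
      rw [← e0, hγ i hi' 1 h11, hγ1, h.map_last i hi']
    have hA := htrans _ _ i hi' a ha 1 h11 (hE1 a ha)
    have hB := htrans _ _ (i + 1) hi 0 h01 b hb (hE0 b hb)
    rw [e0] at hA
    rw [e1] at hB
    rw [g0] at hA hB
    have hab : |cellMap w i a - cellMap w (i + 1) b| =
        |cellMap w i a - meshNode w (i + 1)| + |meshNode w (i + 1) - cellMap w (i + 1) b| := by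
      have h1 := (hw.cellMap_mem hi' ha).2
      have h2 := (hw.cellMap_mem hi hb).1
      rw [abs_of_nonpos (by linarith), abs_of_nonpos (by linarith), abs_of_nonpos (by linarith)]
      ring
    have hXZ := hK i hi _ (hγΛ a ha) _ (hγΛ b hb)
    rw [← hγ i hi' a ha, ← hγ (i + 1) hi b hb] at hXZ
    rw [hab]
    set X' := dist (γ (cellMap w i a)) (p (i + 1))
    set Y' := dist (p (i + 1)) (γ (cellMap w (i + 1) b))
    set Z' := dist (γ (cellMap w i a)) (γ (cellMap w (i + 1) b))
    have hX0 : 0 ≤ X' := dist_nonneg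
    have hY0 : 0 ≤ Y' := dist_nonneg
    have hZ0 : 0 ≤ Z' := dist_nonneg
    have hZ : Z' ≤ X' + Y' := dist_triangle _ _ _
    have hY : Y' ≤ X' + Z' := by
      have := dist_triangle (p (i + 1)) (γ (cellMap w i a)) (γ (cellMap w (i + 1) b))
      rwa [dist_comm (p (i + 1)) (γ (cellMap w i a))] at this
    set α := |cellMap w i a - meshNode w (i + 1)|
    set β := |meshNode w (i + 1) - cellMap w (i + 1) b|
    have hα : 0 ≤ α := abs_nonneg _
    have hβ : 0 ≤ β := abs_nonneg _
    have hKs : 0 < (K + 1) ^ s := Real.rpow_pos_of_pos (by linarith) s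
    constructor
    -- Here `X' ≤ K * Z'` and `Y' ≤ X' + Z' ≤ (K + 1) * Z'`. Adding the bounds for `α` and `β`
    -- accounts for the factor 2 in the constant.
    · have h1 : X' ^ s ≤ (K + 1) ^ s * Z' ^ s := by
        rw [← Real.mul_rpow (by linarith) hZ0]
        exact Real.rpow_le_rpow hX0 (by nlinarith) hs0.le
      have h2 : Y' ^ s ≤ (K + 1) ^ s * Z' ^ s := by
        rw [← Real.mul_rpow (by linarith) hZ0]
        exact Real.rpow_le_rpow hY0 (by nlinarith) hs0.le
      have h3 : c₀ * α ≤ X' ^ s :=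
        (mul_le_mul_of_nonneg_right (min_le_right _ _) hα).trans hA.1
      have h4 : c₀ * β ≤ Y' ^ s :=
        (mul_le_mul_of_nonneg_right (min_le_left _ _) hβ).trans hB.1
      rw [div_mul_eq_mul_div, div_le_iff₀ (by positivity)]
      linarith
    · have h1 : Z' ^ s ≤ 2 ^ s * (X' ^ s + Y' ^ s) := by
        have hmax : Z' ≤ 2 * max X' Y' := by
          linarith [le_max_left X' Y', le_max_right X' Y']
        calc Z' ^ s ≤ (2 * max X' Y') ^ s := Real.rpow_le_rpow hZ0 hmax hs0.le
          _ = 2 ^ s * (max X' Y') ^ s := Real.mul_rpow zero_le_two (hX0.trans (le_max_left _ _))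
          _ ≤ 2 ^ s * (X' ^ s + Y' ^ s) := by
              apply mul_le_mul_of_nonneg_left _ (by positivity)
              rcases max_choice X' Y' with e | e <;> rw [e]
              · linarith [Real.rpow_nonneg hY0 s]
              · linarith [Real.rpow_nonneg hX0 s]
      calc Z' ^ s ≤ 2 ^ s * (X' ^ s + Y' ^ s) := h1
        _ ≤ 2 ^ s * (C₀ * α + C₀ * β) := by
            apply mul_le_mul_of_nonneg_left (add_le_add hA.2 hB.2) (by positivity)
        _ = 2 ^ s * C₀ * (α + β) := by ring
  have hKs : 0 < (K + 1) ^ s := Real.rpow_pos_of_pos (by linarith) s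
  set c : ℝ := min (c₀ / (2 * (K + 1) ^ s)) (δ₂ ^ s) with hc
  set C : ℝ := 2 ^ s * C₀ with hC
  have hcpos : 0 < c := lt_min (by positivity) (Real.rpow_pos_of_pos hδ₂ s)
  have hCpos : 0 < C := by positivity
  have hC₀C : C₀ ≤ C := by
    have := Real.one_le_rpow (show (1 : ℝ) ≤ 2 by norm_num) hs0.le
    nlinarith
  have hmain : ∀ a ∈ Icc (0 : ℝ) 1, ∀ b ∈ Icc (0 : ℝ) 1, a ≤ b →
      (c * |a - b| ≤ dist (γ a) (γ b) ^ s ∧ dist (γ a) (γ b) ^ s ≤ C * |a - b|) := by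
    refine hw.pair_induction hn ?_ (fun j hj a ha b hb => htrans c C j hj a ha b hb) ?_
    · intro a _
      simp [Real.zero_rpow hs0.ne']
    · intro i j hij hj a ha b hb
      rcases (Nat.succ_le_of_lt hij).eq_or_lt with e | hlt
      · subst e
        obtain ⟨h1, h2⟩ := hadj i hj a ha b hb
        exact ⟨(mul_le_mul_of_nonneg_right (min_le_left _ _) (abs_nonneg _)).trans h1, h2⟩
      · have hi : i < n := hij.trans hj
        obtain ⟨h1, h2⟩ := hfar δ₂ hδ₂ _ (hw.cellMap_mem_unit hi ha) _ (hw.cellMap_mem_unit hj hb)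
          (by
            have h1 := (hw.cellMap_mem hi ha).2
            have h2 := (hw.cellMap_mem hj hb).1
            have h3 := hw.meshNode_le (Nat.succ_le_of_lt hlt) hj.le
            have h4 := hm (i + 1) (by omega)
            rw [Nat.succ_eq_add_one, IsUnitMesh.meshNode_succ] at h3
            rw [abs_sub_comm]
            exact le_trans (by linarith) (le_abs_self _))
          (by
            rw [hγ i hi a ha, hγ j hj b hb]
            exact hnonadj i j hlt hj _ (hγΛ a ha) _ (hγΛ b hb))
        exact ⟨(mul_le_mul_of_nonneg_right (min_le_right _ _) (abs_nonneg _)).trans h1,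
          h2.trans (mul_le_mul_of_nonneg_right hC₀C (abs_nonneg _))⟩
  have hmain' : ∀ a ∈ Icc (0 : ℝ) 1, ∀ b ∈ Icc (0 : ℝ) 1,
      (c * |a - b| ≤ dist (γ a) (γ b) ^ s ∧ dist (γ a) (γ b) ^ s ≤ C * |a - b|) := by
    intro a ha b hb
    rcases le_total a b with hab | hab
    · exact hmain a ha b hb hab
    · rw [abs_sub_comm, dist_comm]
      exact hmain b hb a ha hab
  refine ⟨s, c, C, γ, hs, hcpos, hCpos, hγ0, ?_, hmain'⟩
  have hcont : ContinuousOn γ (Icc 0 1) := by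
    intro a ha
    rw [ContinuousWithinAt, tendsto_iff_dist_tendsto_zero]
    have hlim : Tendsto (fun b : ℝ => (C * |b - a|) ^ (1 / s)) (𝓝[Icc 0 1] a) (𝓝 0) := by
      have hc1 : Continuous fun b : ℝ => (C * |b - a|) ^ (1 / s) := by
        refine Continuous.rpow_const (by fun_prop) fun _ => Or.inr (by positivity)
      have := hc1.tendsto a
      rw [sub_self, abs_zero, mul_zero, Real.zero_rpow (by positivity)] at this
      exact this.mono_left nhdsWithin_le_nhds
    refine squeeze_zero' (Eventually.of_forall fun _ => dist_nonneg) ?_ hlim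
    filter_upwards [self_mem_nhdsWithin] with b hb
    rw [← Real.rpow_le_rpow_iff dist_nonneg (by positivity) hs0, ← Real.rpow_mul (by positivity),
      one_div_mul_cancel hs0.ne', Real.rpow_one]
    exact (hmain' b hb a ha).2
  apply Subset.antisymm
  · rintro _ ⟨t, ht, rfl⟩
    exact hγΛ t ht
  -- The image of `γ` is invariant under the maps, hence dense in `Λ`, and it is compact.
  · have hclosed : IsClosed (γ '' Icc 0 1) := (isCompact_Icc.image_of_continuousOn hcont).isClosed
    rw [← hclosed.closure_eq]
    refine h.subset_closure ?_ ⟨γ 0, mem_image_of_mem _ h01⟩ ?_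
    · rintro _ ⟨t, ht, rfl⟩
      exact hγΛ t ht
    · rintro j hj _ ⟨t, ht, rfl⟩
      exact ⟨cellMap w j t, hw.cellMap_mem_unit hj ht, hγ j hj t ht⟩

end IsSimilarityChain

/-! ### Extension of functions with vanishing gradient -/

/-- A function on `E` that is Hölder of exponent `s` extends to a measurable function with the
same modulus of continuity at the points of `E`. -/
lemma exists_measurable_holder_extension {E : Set ℂ} (hE : E.Nonempty) {f : ℂ → ℝ} {s C : ℝ}
    (hs : 0 < s) (hC : 0 ≤ C) (hf : ∀ x ∈ E, ∀ y ∈ E, |f x - f y| ≤ C * dist x y ^ s) :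
    ∃ g : ℂ → ℝ, Measurable g ∧ ∃ B : ℝ, 0 ≤ B ∧ ∀ x, ∀ y ∈ E, |g x - f y| ≤ B * dist x y ^ s := by
  -- The extension is the infimum over `y ∈ E` of `f y + B * |x - y| ^ s`. The factor `2 ^ s`
  -- replaces the triangle inequality, which may fail for `s`-th powers of distances. An infimum of
  -- continuous functions is upper semicontinuous, hence measurable.
  set B : ℝ := 2 ^ s * C with hB
  have hB0 : 0 ≤ B := by positivity
  have hlow : ∀ x, ∀ y ∈ E, ∀ y' ∈ E, f y - B * dist x y ^ s ≤ f y' + B * dist x y' ^ s := by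
    intro x y hy y' hy'
    have h1 := (abs_le.1 (hf y hy y' hy')).2
    have h2 : dist y y' ≤ 2 * max (dist x y) (dist x y') := by
      have := dist_triangle_left y y' x
      linarith [le_max_left (dist x y) (dist x y'), le_max_right (dist x y) (dist x y')]
    have h3 : dist y y' ^ s ≤ 2 ^ s * (dist x y ^ s + dist x y' ^ s) := by
      calc dist y y' ^ s ≤ (2 * max (dist x y) (dist x y')) ^ s :=
            Real.rpow_le_rpow dist_nonneg h2 hs.le
        _ = 2 ^ s * max (dist x y) (dist x y') ^ s :=
            Real.mul_rpow zero_le_two (dist_nonneg.trans (le_max_left _ _))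
        _ ≤ _ := by
            apply mul_le_mul_of_nonneg_left _ (by positivity)
            have ha : 0 ≤ dist x y ^ s := by positivity
            have hb : 0 ≤ dist x y' ^ s := by positivity
            rcases max_choice (dist x y) (dist x y') with e | e <;> rw [e] <;> linarith
    have h4 : C * dist y y' ^ s ≤ B * (dist x y ^ s + dist x y' ^ s) := by
      calc C * dist y y' ^ s ≤ C * (2 ^ s * (dist x y ^ s + dist x y' ^ s)) :=
            mul_le_mul_of_nonneg_left h3 hC
        _ = _ := by rw [hB]; ring
    linarith
  have : Nonempty E := hE.to_subtype
  have hbdd : ∀ x : ℂ, BddBelow (range fun y : E => f y + B * dist x (y : ℂ) ^ s) := by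
    intro x
    obtain ⟨y, hy⟩ := hE
    refine ⟨f y - B * dist x y ^ s, ?_⟩
    rintro _ ⟨y', rfl⟩
    exact hlow x y hy y' y'.2
  refine ⟨fun x => ⨅ y : E, (f y + B * dist x y ^ s), ?_, B, hB0, ?_⟩
  · apply UpperSemicontinuous.measurable
    refine upperSemicontinuous_ciInf hbdd fun y => Continuous.upperSemicontinuous ?_
    have : Continuous fun x : ℂ => dist x (y : ℂ) ^ s :=
      Continuous.rpow_const (by fun_prop) fun _ => Or.inr hs.le
    fun_prop
  · intro x y hy
    rw [abs_le]
    constructor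
    · have : f y - B * dist x y ^ s ≤ ⨅ y : E, (f y + B * dist x y ^ s) :=
        le_ciInf fun y' => hlow x y hy y' y'.2
      linarith
    · have := ciInf_le (hbdd x) ⟨y, hy⟩
      simp only at this
      linarith

/-- Smoothing at unit scale: the smooth function inherits the local bounds. -/
lemma exists_unit_mollification : ∃ A : ℝ, 0 ≤ A ∧ ∀ g : ℂ → ℝ, LocallyIntegrable g →
    ∃ G : ℂ → ℝ, ContDiff ℝ 1 G ∧ ∀ x c ε, (∀ y ∈ Metric.closedBall x 1, |g y - c| ≤ ε) →
      |G x - c| ≤ ε ∧ ‖fderiv ℝ G x‖ ≤ A * ε := by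
  let b : ContDiffBump (0 : ℂ) := ⟨1 / 2, 1, by norm_num, by norm_num⟩
  set φ : ℂ → ℝ := b.normed volume with hφ
  have hφs : HasCompactSupport φ := b.hasCompactSupport_normed
  have hφc : ContDiff ℝ 1 φ := b.contDiff_normed (n := 1)
  have hφ1 : ∫ x, φ x = 1 := b.integral_normed
  have hφ0 : ∀ x, 0 ≤ φ x := b.nonneg_normed
  have hsupp : ∀ t, 1 < ‖t‖ → φ t = 0 := by
    intro t ht
    have : t ∉ Function.support φ := by
      rw [hφ, b.support_normed_eq, Metric.mem_ball, dist_zero_right]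
      exact not_lt.2 ht.le
    simpa using this
  have hsupp' : ∀ t, 1 < ‖t‖ → fderiv ℝ φ t = 0 := by
    intro t ht
    have : φ =ᶠ[𝓝 t] fun _ => 0 := by
      filter_upwards [(isOpen_lt continuous_const continuous_norm).mem_nhds ht] with u hu
      exact hsupp u hu
    rw [this.fderiv_eq]
    simp
  have hφi : Integrable φ := hφc.continuous.integrable_of_hasCompactSupport hφs
  have hDi : Integrable (fun t => ‖fderiv ℝ φ t‖) :=
    ((hφc.continuous_fderiv one_ne_zero).integrable_of_hasCompactSupport (hφs.fderiv ℝ)).norm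
  refine ⟨∫ t, ‖fderiv ℝ φ t‖, integral_nonneg fun _ => norm_nonneg _, fun g hg => ?_⟩
  set L := ContinuousLinearMap.lsmul ℝ ℝ (E := ℝ) with hL
  -- The kernel has mass 1 and support in the unit ball, so `|k| ≤ ε` on that ball bounds the
  -- average by `ε` and its gradient by `ε` times the `L¹` norm of the kernel's gradient. This is
  -- then applied to `k = g - c`.
  have hbound : ∀ k : ℂ → ℝ, LocallyIntegrable k → ∀ x ε, (∀ y ∈ Metric.closedBall x 1, |k y| ≤ ε) →
      |(φ ⋆[L] k) x| ≤ ε ∧ ‖fderiv ℝ (φ ⋆[L] k) x‖ ≤ (∫ t, ‖fderiv ℝ φ t‖) * ε := by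
    intro k hk x ε hε
    constructor
    · rw [convolution_def, ← Real.norm_eq_abs]
      calc ‖∫ t, L (φ t) (k (x - t))‖ ≤ ∫ t, φ t * ε := by
            refine norm_integral_le_of_norm_le (hφi.mul_const ε) (Eventually.of_forall fun t => ?_)
            rw [hL, ContinuousLinearMap.lsmul_apply, norm_smul, Real.norm_eq_abs, Real.norm_eq_abs,
              abs_of_nonneg (hφ0 t)]
            rcases le_or_gt ‖t‖ 1 with ht | ht
            · exact mul_le_mul_of_nonneg_left (hε _ (by simpa using ht)) (hφ0 t)
            · simp [hsupp t ht]
        _ = ε := by rw [integral_mul_const, hφ1, one_mul]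
    · rw [(hφs.hasFDerivAt_convolution_left L hφc hk x).fderiv, convolution_def]
      calc _ ≤ ∫ t, ‖fderiv ℝ φ t‖ * ε := by
            refine norm_integral_le_of_norm_le (hDi.mul_const ε) (Eventually.of_forall fun t => ?_)
            rcases le_or_gt ‖t‖ 1 with ht | ht
            · have h1 : |k (x - t)| ≤ ε := hε _ (by simpa using ht)
              refine ContinuousLinearMap.opNorm_le_bound _
                (mul_nonneg (norm_nonneg _) ((abs_nonneg _).trans h1)) fun v => ?_
              rw [ContinuousLinearMap.precompL_apply, hL, ContinuousLinearMap.lsmul_apply,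
                norm_smul, Real.norm_eq_abs (k _)]
              calc ‖fderiv ℝ φ t v‖ * |k (x - t)| ≤ (‖fderiv ℝ φ t‖ * ‖v‖) * ε :=
                    mul_le_mul (ContinuousLinearMap.le_opNorm _ _) h1 (abs_nonneg _) (by positivity)
                _ = _ := by ring
            · simp [hsupp' t ht]
        _ = _ := integral_mul_const _ _
  refine ⟨φ ⋆[L] g, hφs.contDiff_convolution_left L (n := 1) hφc hg, fun x c ε h => ?_⟩
  have hk : LocallyIntegrable fun y => g y - c := hg.sub (locallyIntegrable_const c)
  -- A kernel of mass 1 reproduces constants.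
  have hsub : φ ⋆[L] g = fun x => (φ ⋆[L] fun y => g y - c) x + c := by
    funext x
    simp only [convolution_def, hL, ContinuousLinearMap.lsmul_apply, smul_eq_mul]
    have h1 : Integrable fun t => φ t * (g (x - t) - c) :=
      (hφs.convolutionExists_left L hφc.continuous hk x)
    calc ∫ t, φ t * g (x - t) = ∫ t, (φ t * (g (x - t) - c) + φ t * c) := by
          congr 1; funext t; ring
      _ = _ := by rw [integral_add h1 (hφi.mul_const c), integral_mul_const, hφ1, one_mul]
  obtain ⟨h1, h2⟩ := hbound _ hk x ε h
  rw [hsub]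
  refine ⟨by simpa using h1, ?_⟩
  rw [fderiv_add_const]
  exact h2

/-- Smoothing at scale `δ`. -/
lemma exists_mollification : ∃ A : ℝ, 0 ≤ A ∧ ∀ δ > 0, ∀ g : ℂ → ℝ, LocallyIntegrable g →
    ∃ G : ℂ → ℝ, ContDiff ℝ 1 G ∧ ∀ x c ε, (∀ y ∈ Metric.closedBall x δ, |g y - c| ≤ ε) →
      |G x - c| ≤ ε ∧ ‖fderiv ℝ G x‖ ≤ A * ε / δ := by
  obtain ⟨A, hA, H⟩ := exists_unit_mollification
  refine ⟨A, hA, fun δ hδ g hg => ?_⟩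
  -- The dilation `u ↦ δ • u` reduces the claim to unit scale; the gradient picks up the factor `1 /
  -- δ`.
  have hg' : LocallyIntegrable fun u : ℂ => g (δ • u) := by
    rw [locallyIntegrable_iff] at hg ⊢
    intro K hK
    have h1 := hg ((fun u : ℂ => δ • u) '' K) (hK.image (by fun_prop))
    have he : MeasurableEmbedding fun u : ℂ => δ • u :=
      (Homeomorph.smulOfNeZero δ hδ.ne').measurableEmbedding
    have h2 : IntegrableOn g ((fun u : ℂ => δ • u) '' K)
        (Measure.map (fun u : ℂ => δ • u) volume) := by
      rw [Measure.map_addHaar_smul _ hδ.ne']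
      rw [IntegrableOn, Measure.restrict_smul]
      exact Integrable.smul_measure h1 ENNReal.ofReal_ne_top
    rw [he.integrableOn_map_iff, preimage_image_eq _ he.injective] at h2
    exact h2
  obtain ⟨G, hG, hGb⟩ := H _ hg'
  refine ⟨fun x => G (δ⁻¹ • x), hG.comp (by fun_prop), fun x c ε h => ?_⟩
  obtain ⟨h1, h2⟩ := hGb (δ⁻¹ • x) c ε (by
    intro y hy
    refine h _ ?_
    rw [mem_closedBall_iff_norm] at hy ⊢
    have : δ • y - x = δ • (y - δ⁻¹ • x) := by rw [smul_sub, smul_inv_smul₀ hδ.ne']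
    rw [this, norm_smul, Real.norm_of_nonneg hδ.le]
    nlinarith)
  refine ⟨h1, ?_⟩
  have hd : HasFDerivAt (fun x : ℂ => G (δ⁻¹ • x))
      ((fderiv ℝ G (δ⁻¹ • x)).comp (δ⁻¹ • ContinuousLinearMap.id ℝ ℂ)) x :=
    ((hG.differentiable one_ne_zero _).hasFDerivAt).comp x
      ((δ⁻¹ • ContinuousLinearMap.id ℝ ℂ).hasFDerivAt)
  rw [hd.fderiv, ContinuousLinearMap.comp_smul, ContinuousLinearMap.comp_id, norm_smul,
    Real.norm_of_nonneg (inv_nonneg.2 hδ.le), div_eq_inv_mul]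
  exact mul_le_mul_of_nonneg_left h2 (inv_nonneg.2 hδ.le)

/-- A function on a compact set that is Hölder of exponent `s > 1` is the restriction of a `C¹`
function whose gradient vanishes on the set. -/
theorem exists_contDiff_extension_of_holder {E : Set ℂ} (hE : E.Nonempty)
    {f : ℂ → ℝ} {s C : ℝ} (hs : 1 < s) (hC : 0 ≤ C)
    (hf : ∀ x ∈ E, ∀ y ∈ E, |f x - f y| ≤ C * dist x y ^ s) :
    ∃ F : ℂ → ℝ, ContDiff ℝ 1 F ∧ (∀ x ∈ E, fderiv ℝ F x = 0) ∧ ∀ x ∈ E, F x = f x := by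
  have hs0 : 0 < s := by linarith
  obtain ⟨g, hgm, B, hB, hg⟩ := exists_measurable_holder_extension hE hs0 hC hf
  obtain ⟨A, hA, hmol⟩ := exists_mollification
  have hgi : LocallyIntegrable g := by
    obtain ⟨y, hy⟩ := hE
    have hcont : Continuous fun x : ℂ => |f y| + B * dist x y ^ s := by
      have : Continuous fun x : ℂ => dist x y ^ s :=
        Continuous.rpow_const (by fun_prop) fun _ => Or.inr hs0.le
      fun_prop
    refine hcont.locallyIntegrable.mono hgm.aestronglyMeasurable (Eventually.of_forall fun x => ?_)
    have h1 := hg x y hy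
    have h2 := abs_sub_abs_le_abs_sub (g x) (f y)
    rw [Real.norm_eq_abs, Real.norm_eq_abs]
    exact le_trans (by linarith) (le_abs_self _)
  -- The extension will be `Φ 0 + ∑ χ n * (Φ (n + 1) - Φ n)`, with `Φ n` the mollification of `g` at
  -- scale `δ n` and `χ n` a cutoff. On `E` the cutoffs equal 1 to first order, so both the sum and
  -- its gradient telescope. Off a neighbourhood of `E` of size comparable to `δ n` the `n`-th term
  -- vanishes.
  set δ : ℕ → ℝ := fun n => (1 / 2) ^ n with hδ
  have hδ0 : ∀ n, 0 < δ n := fun n => by positivity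
  have hδs : ∀ n, δ (n + 1) = δ n / 2 := fun n => by simp only [hδ, pow_succ]; ring
  choose Φ hΦc hΦ using fun n => hmol (δ n) (hδ0 n) g hgi
  -- Smoothing at scale `δ n` the indicator of the `2 * δ n`-neighbourhood leaves 1 near `E` and 0
  -- at distance at least `3 * δ n`.
  have hki : ∀ n, LocallyIntegrable (indicator {x | Metric.infDist x E < 2 * δ n} fun _ => (1 : ℝ)) :=
    fun n => (locallyIntegrable_const 1).indicator
      (isOpen_lt (Metric.continuous_infDist_pt E) continuous_const).measurableSet
  choose χ hχc hχ using fun n => hmol (δ n) (hδ0 n) _ (hki n)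
  have hχle : ∀ n x, |χ n x| ≤ 1 ∧ ‖fderiv ℝ (χ n) x‖ ≤ A / δ n := by
    intro n x
    have := hχ n x 0 1 (by
      intro y _
      by_cases hy : y ∈ {x | Metric.infDist x E < 2 * δ n}
      · simp [indicator_of_mem hy]
      · simp [indicator_of_notMem hy])
    simpa using this
  have hχ1 : ∀ n, ∀ x ∈ E, χ n x = 1 ∧ fderiv ℝ (χ n) x = 0 := by
    intro n x hx
    -- The indicator is constant on the ball, so `ε = 0` gives the value and the zero gradient
    -- together.
    have := hχ n x 1 0 (by
      intro y hy
      have hy' : y ∈ {x | Metric.infDist x E < 2 * δ n} := by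
        have := Metric.infDist_le_dist_of_mem (x := y) hx
        have h2 := Metric.mem_closedBall.1 hy
        have := hδ0 n
        simp only [mem_ofPred_eq]
        linarith
      simp [indicator_of_mem hy'])
    simp only [mul_zero, zero_div, norm_le_zero_iff] at this
    exact ⟨sub_eq_zero.1 (abs_nonpos_iff.1 this.1), this.2⟩
  have hχ0 : ∀ n x, 3 * δ n ≤ Metric.infDist x E → χ n x = 0 ∧ fderiv ℝ (χ n) x = 0 := by
    intro n x hx
    have := hχ n x 0 0 (by
      intro y hy
      have hy' : y ∉ {x | Metric.infDist x E < 2 * δ n} := by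
        have h1 := Metric.infDist_le_infDist_add_dist (s := E) (x := x) (y := y)
        have h2 := Metric.mem_closedBall'.1 hy
        simp only [mem_ofPred_eq]
        linarith
      simp [indicator_of_notMem hy'])
    simpa using this
  -- The 5 is the distance `4 * δ n` from `x` to `y` plus a smoothing radius of at most `δ n`.
  set M : ℝ := B * 5 ^ s with hM
  have hM0 : 0 ≤ M := by positivity
  have hΦnear : ∀ n m, n ≤ m → m ≤ n + 1 → ∀ x, ∀ y ∈ E, dist x y ≤ 4 * δ n →
      |Φ m x - f y| ≤ M * δ n ^ s ∧ ‖fderiv ℝ (Φ m) x‖ ≤ 2 * A * (M * δ n ^ s) / δ n := by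
    intro n m hnm hmn x y hy hxy
    have hm : δ n ≤ 2 * δ m ∧ δ m ≤ δ n := by
      have := hδ0 n
      rcases (show m = n ∨ m = n + 1 by omega) with rfl | rfl
      · exact ⟨by linarith, le_rfl⟩
      · rw [hδs]; exact ⟨by linarith, by linarith⟩
    obtain ⟨h1, h2⟩ := hΦ m x (f y) (M * δ n ^ s) (by
      intro v hv
      refine (hg v y hy).trans ?_
      rw [hM, mul_assoc, ← Real.mul_rpow (by norm_num) (hδ0 n).le]
      apply mul_le_mul_of_nonneg_left _ hB
      refine Real.rpow_le_rpow dist_nonneg ?_ hs0.le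
      have h3 := dist_triangle v x y
      have h4 := Metric.mem_closedBall.1 hv
      linarith [hm.2])
    refine ⟨h1, h2.trans ?_⟩
    rw [div_le_div_iff₀ (hδ0 m) (hδ0 n)]
    have : 0 ≤ A * (M * δ n ^ s) := by have := hδ0 n; positivity
    nlinarith [hm.1]
  -- Gradients at stage `n` are of order `δ n ^ (s - 1) = q ^ n`. They are summable exactly because
  -- `s > 1`.
  set q : ℝ := (1 / 2) ^ (s - 1) with hq
  have hq0 : 0 ≤ q := by positivity
  have hq1 : q < 1 := Real.rpow_lt_one (by norm_num) (by norm_num) (by linarith)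
  have hδq : ∀ n, δ n ^ s / δ n = q ^ n := by
    intro n
    rw [← Real.rpow_sub_one (hδ0 n).ne']
    simp only [hδ, hq]
    rw [← Real.rpow_natCast, ← Real.rpow_mul (by norm_num), ← Real.rpow_natCast,
      ← Real.rpow_mul (by norm_num), mul_comm]
  have hδq' : ∀ n, δ n ^ s ≤ q ^ n := by
    intro n
    rw [← hδq, le_div_iff₀ (hδ0 n)]
    have h1 : δ n ≤ 1 := pow_le_one₀ (by norm_num) (by norm_num)
    have h2 : 0 ≤ δ n ^ s := Real.rpow_nonneg (hδ0 n).le _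
    nlinarith
  set u : ℕ → ℂ → ℝ := fun n x => χ n x * (Φ (n + 1) x - Φ n x) with hu
  have hdc : ∀ n, ContDiff ℝ 1 fun x => Φ (n + 1) x - Φ n x := fun n => (hΦc _).sub (hΦc _)
  have huc : ∀ n, ContDiff ℝ 1 (u n) := fun n => (hχc n).mul (hdc n)
  have hud : ∀ n x, fderiv ℝ (u n) x =
      χ n x • (fderiv ℝ (Φ (n + 1)) x - fderiv ℝ (Φ n) x) +
        (Φ (n + 1) x - Φ n x) • fderiv ℝ (χ n) x := by
    intro n x
    have h1 := (hχc n).differentiable one_ne_zero x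
    have h2 := (hΦc (n + 1)).differentiable one_ne_zero x
    have h3 := (hΦc n).differentiable one_ne_zero x
    exact (h1.hasFDerivAt.mul (h2.hasFDerivAt.sub h3.hasFDerivAt)).fderiv
  -- In the constant `6`, the difference of gradients contributes 4 and the gradient of the cutoff
  -- 2.
  have hub : ∀ n x, |u n x| ≤ 2 * M * q ^ n ∧ ‖fderiv ℝ (u n) x‖ ≤ 6 * A * M * q ^ n := by
    intro n x
    rcases le_or_gt (3 * δ n) (Metric.infDist x E) with hx | hx
    · obtain ⟨h1, h2⟩ := hχ0 n x hx
      rw [hud, h1, h2]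
      simp only [hu, h1, zero_mul, abs_zero, zero_smul, smul_zero, add_zero, norm_zero]
      exact ⟨by positivity, by positivity⟩
    · obtain ⟨y, hy, hxy⟩ := (Metric.infDist_lt_iff hE).1 hx
      have hxy' : dist x y ≤ 4 * δ n := by linarith [hδ0 n]
      obtain ⟨a1, a2⟩ := hΦnear n n le_rfl (by omega) x y hy hxy'
      obtain ⟨b1, b2⟩ := hΦnear n (n + 1) (by omega) le_rfl x y hy hxy'
      obtain ⟨c1, c2⟩ := hχle n x
      have hd : |Φ (n + 1) x - Φ n x| ≤ 2 * (M * δ n ^ s) := by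
        have := abs_sub_le (Φ (n + 1) x) (f y) (Φ n x)
        rw [abs_sub_comm (f y)] at this
        linarith
      have hD : ‖fderiv ℝ (Φ (n + 1)) x - fderiv ℝ (Φ n) x‖ ≤
          2 * (2 * A * (M * δ n ^ s) / δ n) := by
        have := norm_sub_le (fderiv ℝ (Φ (n + 1)) x) (fderiv ℝ (Φ n) x)
        linarith
      constructor
      · simp only [hu, abs_mul]
        calc |χ n x| * |Φ (n + 1) x - Φ n x| ≤ 1 * (2 * (M * δ n ^ s)) :=
              mul_le_mul c1 hd (abs_nonneg _) zero_le_one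
          _ ≤ 2 * M * q ^ n := by nlinarith [hδq' n]
      · rw [hud]
        refine (norm_add_le _ _).trans ?_
        rw [norm_smul, norm_smul, Real.norm_eq_abs, Real.norm_eq_abs]
        have e1 : |χ n x| * ‖fderiv ℝ (Φ (n + 1)) x - fderiv ℝ (Φ n) x‖ ≤
            1 * (2 * (2 * A * (M * δ n ^ s) / δ n)) :=
          mul_le_mul c1 hD (norm_nonneg _) zero_le_one
        have e2 : |Φ (n + 1) x - Φ n x| * ‖fderiv ℝ (χ n) x‖ ≤ 2 * (M * δ n ^ s) * (A / δ n) :=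
          mul_le_mul hd c2 (norm_nonneg _)
            (mul_nonneg zero_le_two (mul_nonneg hM0 (Real.rpow_nonneg (hδ0 n).le _)))
        have e3 : 1 * (2 * (2 * A * (M * δ n ^ s) / δ n)) + 2 * (M * δ n ^ s) * (A / δ n) =
            6 * A * M * (δ n ^ s / δ n) := by ring
        rw [hδq] at e3
        linarith
  have hsq : Summable fun n : ℕ => q ^ n := summable_geometric_of_lt_one hq0 hq1
  have hqlim : Tendsto (fun n : ℕ => q ^ n) atTop (𝓝 0) :=
    tendsto_pow_atTop_nhds_zero_of_lt_one hq0 hq1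
  have hUc : ContDiff ℝ 1 fun x => ∑' n, u n x := by
    refine contDiff_tsum (N := 1)
      (v := fun k n => if k = 0 then 2 * M * q ^ n else 6 * A * M * q ^ n) huc ?_ ?_
    · intro k _
      by_cases hk : k = 0
      · simp only [hk, if_true]; exact hsq.mul_left _
      · simp only [hk, if_false]; exact hsq.mul_left _
    · intro k n x hk
      have hk' : k ≤ 1 := by exact_mod_cast hk
      rcases (show k = 0 ∨ k = 1 by omega) with rfl | rfl
      · rw [norm_iteratedFDeriv_zero, if_pos rfl]
        exact (hub n x).1
      · rw [norm_iteratedFDeriv_one, if_neg one_ne_zero]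
        exact (hub n x).2
  have hsum : ∀ x, Summable fun n => u n x := fun x =>
    Summable.of_norm_bounded (hsq.mul_left (2 * M)) fun n => (hub n x).1
  have hsumd : ∀ x, Summable fun n => fderiv ℝ (u n) x := fun x =>
    Summable.of_norm_bounded (hsq.mul_left (6 * A * M)) fun n => (hub n x).2
  have hUd : ∀ x, fderiv ℝ (fun x => ∑' n, u n x) x = ∑' n, fderiv ℝ (u n) x := by
    intro x
    exact (hasFDerivAt_tsum (hsq.mul_left (6 * A * M))
      (fun n y => ((huc n).differentiable one_ne_zero y).hasFDerivAt) (fun n y => (hub n y).2)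
      (hsum 0) x).fderiv
  refine ⟨fun x => Φ 0 x + ∑' n, u n x, (hΦc 0).add hUc, fun x hx => ?_, fun x hx => ?_⟩
  · have h1 : HasFDerivAt (fun x => Φ 0 x + ∑' n, u n x)
        (fderiv ℝ (Φ 0) x + ∑' n, fderiv ℝ (u n) x) x := by
      rw [← hUd]
      exact (((hΦc 0).differentiable one_ne_zero x).hasFDerivAt).add
        ((hUc.differentiable one_ne_zero x).hasFDerivAt)
    rw [h1.fderiv]
    have h2 : ∀ n, fderiv ℝ (u n) x = fderiv ℝ (Φ (n + 1)) x - fderiv ℝ (Φ n) x := by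
      intro n
      rw [hud, (hχ1 n x hx).1, (hχ1 n x hx).2]
      simp
    have h3 : Tendsto (fun n => fderiv ℝ (Φ n) x) atTop (𝓝 0) := by
      rw [tendsto_zero_iff_norm_tendsto_zero]
      refine squeeze_zero (fun _ => norm_nonneg _) (fun n => ?_)
        (by simpa using hqlim.const_mul (2 * A * M))
      refine (hΦnear n n le_rfl (by omega) x x hx (by simp [(hδ0 n).le])).2.trans (le_of_eq ?_)
      rw [← hδq]; ring
    have h4 := (hsumd x).hasSum.tendsto_sum_nat
    simp only [h2, Finset.sum_range_sub (fun n => fderiv ℝ (Φ n) x)] at h4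
    have h5 := tendsto_nhds_unique h4 (h3.sub_const _)
    simp only [h2, h5]
    simp
  · have h2 : ∀ n, u n x = Φ (n + 1) x - Φ n x := by
      intro n
      simp only [hu, (hχ1 n x hx).1, one_mul]
    have h3 : Tendsto (fun n => Φ n x) atTop (𝓝 (f x)) := by
      rw [tendsto_iff_dist_tendsto_zero]
      refine squeeze_zero (fun _ => dist_nonneg) (fun n => ?_)
        (by simpa using hqlim.const_mul M)
      rw [Real.dist_eq]
      refine (hΦnear n n le_rfl (by omega) x x hx (by simp [(hδ0 n).le])).1.trans ?_
      exact mul_le_mul_of_nonneg_left (hδq' n) hM0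
    have h4 := (hsum x).hasSum.tendsto_sum_nat
    simp only [h2, Finset.sum_range_sub (fun n => Φ n x)] at h4
    have h5 := tendsto_nhds_unique h4 (h3.sub_const _)
    simp only [h2, h5]
    ring

/-! ### Arcs with a power-like parametrization -/

/-- The subarc between two points does not depend on the parametrization of the arc. -/
lemma subarc_eq_subarc {E : Set ℂ} (h e : unitInterval ≃ₜ E) (x y : ℂ) :
    subarc h x y = subarc e x y := by
  have key : ∀ h e : unitInterval ≃ₜ E, subarc h x y ⊆ subarc e x y := by
    rintro h e w ⟨a, b, c, rfl, rfl, hc, rfl⟩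
    let φ := h.trans e.symm
    have hφ : ∀ t, (e (φ t) : ℂ) = h t := fun t => by simp [φ]
    refine ⟨φ a, φ b, φ c, hφ a, hφ b, ?_, hφ c⟩
    -- The change of parameter is monotone or antitone, and either kind preserves betweenness.
    rcases φ.continuous.strictMono_of_inj φ.injective with hm | hm
    · rcases mem_uIcc.1 hc with ⟨h1, h2⟩ | ⟨h1, h2⟩
      · exact mem_uIcc.2 (Or.inl ⟨hm.monotone h1, hm.monotone h2⟩)
      · exact mem_uIcc.2 (Or.inr ⟨hm.monotone h1, hm.monotone h2⟩)
    · rcases mem_uIcc.1 hc with ⟨h1, h2⟩ | ⟨h1, h2⟩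
      · exact mem_uIcc.2 (Or.inr ⟨hm.antitone h2, hm.antitone h1⟩)
      · exact mem_uIcc.2 (Or.inl ⟨hm.antitone h2, hm.antitone h1⟩)
  exact Subset.antisymm (key h e) (key e h)

/-- The map `γ` of `[0, 1]` onto `E` satisfies `c |a - b| ≤ |γ a - γ b| ^ s ≤ C |a - b|`. -/
structure IsSnowflakeParametrization (s c C : ℝ) (γ : ℝ → ℂ) (E : Set ℂ) : Prop where
  one_lt : 1 < s
  c_pos : 0 < c
  C_pos : 0 < C
  image_eq : γ '' Icc 0 1 = E
  lower : ∀ a ∈ Icc (0 : ℝ) 1, ∀ b ∈ Icc (0 : ℝ) 1, c * |a - b| ≤ dist (γ a) (γ b) ^ s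
  upper : ∀ a ∈ Icc (0 : ℝ) 1, ∀ b ∈ Icc (0 : ℝ) 1, dist (γ a) (γ b) ^ s ≤ C * |a - b|

namespace IsSnowflakeParametrization

variable {s c C : ℝ} {γ : ℝ → ℂ} {E : Set ℂ}

lemma exponent_pos (hγ : IsSnowflakeParametrization s c C γ E) : 0 < s :=
  zero_lt_one.trans hγ.one_lt

lemma injOn (hγ : IsSnowflakeParametrization s c C γ E) : InjOn γ (Icc 0 1) := by
  intro a ha b hb he
  have h1 := hγ.lower a ha b hb
  rw [he, dist_self, Real.zero_rpow hγ.exponent_pos.ne'] at h1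
  have h2 := hγ.c_pos
  have h3 : |a - b| = 0 := by nlinarith [abs_nonneg (a - b)]
  exact sub_eq_zero.1 (abs_eq_zero.1 h3)

/-- The `s`-th root of `upper`, in the form needed for bounding Hausdorff measures of images. -/
lemma holderOnWith (hγ : IsSnowflakeParametrization s c C γ E) :
    HolderOnWith (Real.toNNReal (C ^ (1 / s))) (Real.toNNReal (1 / s)) γ (Icc 0 1) := by
  have hs := hγ.exponent_pos
  have hC := hγ.C_pos
  intro a ha b hb
  rw [edist_dist, edist_dist, Real.coe_toNNReal _ (by positivity),
    ENNReal.ofReal_rpow_of_nonneg dist_nonneg (by positivity)]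
  -- `ENNReal.ofReal` is by definition the coercion of `Real.toNNReal`.
  change _ ≤ ENNReal.ofReal _ * _
  rw [← ENNReal.ofReal_mul (by positivity), ← Real.mul_rpow hC.le dist_nonneg]
  apply ENNReal.ofReal_le_ofReal
  rw [← Real.rpow_le_rpow_iff dist_nonneg (by positivity) hs, ← Real.rpow_mul (by positivity),
    one_div_mul_cancel hs.ne', Real.rpow_one]
  exact hγ.upper a ha b hb

lemma continuousOn (hγ : IsSnowflakeParametrization s c C γ E) : ContinuousOn γ (Icc 0 1) :=
  hγ.holderOnWith.continuousOn (by simpa using hγ.exponent_pos)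

lemma exists_homeomorph (hγ : IsSnowflakeParametrization s c C γ E) :
    ∃ e : unitInterval ≃ₜ E, ∀ t, (e t : ℂ) = γ t := by
  have hmem : ∀ t : unitInterval, γ t ∈ E := fun t => hγ.image_eq ▸ mem_image_of_mem γ t.2
  let g : unitInterval → E := fun t => ⟨γ t, hmem t⟩
  have hg : Continuous g :=
    (continuousOn_iff_continuous_domRestrict.1 hγ.continuousOn).subtype_mk _
  have hbij : Function.Bijective g := by
    constructor
    · intro a b hab
      exact Subtype.ext (hγ.injOn a.2 b.2 (congrArg Subtype.val hab))
    · rintro ⟨x, hx⟩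
      obtain ⟨t, ht, rfl⟩ := hγ.image_eq.symm ▸ hx
      exact ⟨⟨t, ht⟩, rfl⟩
  exact ⟨Continuous.homeoOfEquivCompactToT2 (f := Equiv.ofBijective g hbij) hg, fun _ => rfl⟩

lemma subarc_eq_image (hγ : IsSnowflakeParametrization s c C γ E) (h : unitInterval ≃ₜ E)
    {a b : ℝ} (ha : a ∈ Icc (0 : ℝ) 1) (hb : b ∈ Icc (0 : ℝ) 1) :
    subarc h (γ a) (γ b) = γ '' uIcc a b := by
  obtain ⟨e, he⟩ := hγ.exists_homeomorph
  rw [subarc_eq_subarc h e]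
  ext w
  constructor
  · rintro ⟨a', b', c', h1, h2, h3, rfl⟩
    rw [he] at h1 h2 ⊢
    have e1 := hγ.injOn a'.2 ha h1
    have e2 := hγ.injOn b'.2 hb h2
    refine ⟨c', ?_, rfl⟩
    rw [← e1, ← e2, mem_uIcc]
    exact mem_uIcc.1 h3
  · rintro ⟨t, ht, rfl⟩
    have ht' : t ∈ Icc (0 : ℝ) 1 := uIcc_subset_Icc ha hb ht
    refine ⟨⟨a, ha⟩, ⟨b, hb⟩, ⟨t, ht'⟩, he _, he _, ?_, he _⟩
    rw [mem_uIcc] at ht ⊢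
    exact ht

/-- Two points of a subarc have parameters no farther apart than those of its ends, so its diameter
is at most `(C / c) ^ (1 / s)` times the distance of the ends. For larger `t` the remaining power `t
- 1` of the diameter is bounded by that of `diam E + 1`. -/
lemma isTQuasiArc (hγ : IsSnowflakeParametrization s c C γ E) {t : ℝ} (ht : 1 ≤ t) :
    IsTQuasiArc t E := by
  have hs := hγ.exponent_pos
  have hC := hγ.C_pos
  have hc := hγ.c_pos
  obtain ⟨e, -⟩ := hγ.exists_homeomorph
  set k : ℝ := (C / c) ^ (1 / s) with hk
  have hk0 : 0 < k := by positivity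
  have hbE : Bornology.IsBounded E := by
    rw [← hγ.image_eq]
    exact (isCompact_Icc.image_of_continuousOn hγ.continuousOn).isBounded
  set D : ℝ := Metric.diam E + 1
  have hD : 0 < D := by have := Metric.diam_nonneg (s := E); positivity
  refine ⟨ht, e, D ^ (t - 1) * k, by positivity, ?_⟩
  intro x hx y hy
  obtain ⟨a, ha, rfl⟩ := hγ.image_eq.symm ▸ hx
  obtain ⟨b, hb, rfl⟩ := hγ.image_eq.symm ▸ hy
  rw [hγ.subarc_eq_image e ha hb]
  have hsub : uIcc a b ⊆ Icc 0 1 := uIcc_subset_Icc ha hb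
  have h1 : Metric.diam (γ '' uIcc a b) ≤ k * dist (γ a) (γ b) := by
    refine Metric.diam_le_of_forall_dist_le (by positivity) ?_
    rintro _ ⟨u, hu, rfl⟩ _ ⟨v, hv, rfl⟩
    rw [← Real.rpow_le_rpow_iff dist_nonneg (by positivity) hs,
      Real.mul_rpow hk0.le dist_nonneg, hk, ← Real.rpow_mul (by positivity),
      one_div_mul_cancel hs.ne', Real.rpow_one]
    have huv : |u - v| ≤ |a - b| := by
      rw [abs_sub_comm a b]
      exact abs_sub_le_of_uIcc_subset_uIcc (uIcc_subset_uIcc hv hu)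
    calc dist (γ u) (γ v) ^ s ≤ C * |u - v| := hγ.upper u (hsub hu) v (hsub hv)
      _ ≤ C * |a - b| := mul_le_mul_of_nonneg_left huv hC.le
      _ = C / c * (c * |a - b|) := by field_simp
      _ ≤ C / c * dist (γ a) (γ b) ^ s :=
        mul_le_mul_of_nonneg_left (hγ.lower a ha b hb) (by positivity)
  have h2 : Metric.diam (γ '' uIcc a b) ≤ D := by
    have : γ '' uIcc a b ⊆ E := hγ.image_eq ▸ image_mono hsub
    linarith [Metric.diam_mono this hbE]
  set d := Metric.diam (γ '' uIcc a b) with hd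
  have hd0 : 0 ≤ d := Metric.diam_nonneg
  calc d ^ t = d ^ (t - 1) * d := by
        rcases hd0.eq_or_lt with h | h
        · rw [← h, mul_zero, Real.zero_rpow (by linarith)]
        · rw [← Real.rpow_add_one h.ne', sub_add_cancel]
    _ ≤ D ^ (t - 1) * (k * dist (γ a) (γ b)) :=
        mul_le_mul (Real.rpow_le_rpow hd0 h2 (by linarith)) h1 hd0 (by positivity)
    _ = D ^ (t - 1) * k * dist (γ a) (γ b) := by ring

/-- A Hölder map of exponent `1 / s` turns length into `H^s`, up to the `s`-th power of its
constant, which is `C`. -/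
lemma hausdorffMeasure_image_Icc_le (hγ : IsSnowflakeParametrization s c C γ E) {a b : ℝ}
    (ha : 0 ≤ a) (hb : b ≤ 1) : μH[s] (γ '' Icc a b) ≤ ENNReal.ofReal (C * (b - a)) := by
  have hs := hγ.exponent_pos
  have hC := hγ.C_pos
  have h1 := (hγ.holderOnWith.mono (Icc_subset_Icc ha hb)).hausdorffMeasure_image_le
    (by simpa using hs) hs.le
  refine h1.trans (le_of_eq ?_)
  rw [Real.coe_toNNReal _ (by positivity), one_div_mul_cancel hs.ne', hausdorffMeasure_real,
    Real.volume_Icc]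
  change ENNReal.ofReal _ ^ s * _ = _
  rw [ENNReal.ofReal_rpow_of_nonneg (by positivity) hs.le, ← Real.rpow_mul hC.le,
    one_div_mul_cancel hs.ne', Real.rpow_one, ← ENNReal.ofReal_mul hC.le]

/-- By `lower` the inverse of `γ` is Hölder of exponent `s`. If the image were `H^s`-null, the
interval would have length zero. -/
lemma hausdorffMeasure_image_Ioc_pos (hγ : IsSnowflakeParametrization s c C γ E) {a b : ℝ}
    (ha : 0 ≤ a) (hab : a < b) (hb : b ≤ 1) : 0 < μH[s] (γ '' Ioc a b) := by
  have hs := hγ.exponent_pos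
  have hc := hγ.c_pos
  have hsub : Ioc a b ⊆ Icc 0 1 := fun t ht => ⟨ha.trans ht.1.le, ht.2.trans hb⟩
  set g := Function.invFunOn γ (Icc (0 : ℝ) 1)
  have hg : ∀ t ∈ Icc (0 : ℝ) 1, g (γ t) = t := fun t ht => hγ.injOn.leftInvOn_invFunOn ht
  have hhol : HolderOnWith (Real.toNNReal c⁻¹) (Real.toNNReal s) g (γ '' Ioc a b) := by
    rintro _ ⟨u, hu, rfl⟩ _ ⟨v, hv, rfl⟩
    rw [hg u (hsub hu), hg v (hsub hv), edist_dist, edist_dist, Real.coe_toNNReal _ hs.le,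
      ENNReal.ofReal_rpow_of_nonneg dist_nonneg hs.le]
    change _ ≤ ENNReal.ofReal _ * _
    rw [← ENNReal.ofReal_mul (by positivity)]
    apply ENNReal.ofReal_le_ofReal
    rw [inv_mul_eq_div, le_div_iff₀ hc, mul_comm]
    exact hγ.lower u (hsub hu) v (hsub hv)
  have h1 := hhol.hausdorffMeasure_image_le (by simpa using hs) zero_le_one
  have h2 : g '' (γ '' Ioc a b) = Ioc a b := by
    rw [image_image]
    exact (image_congr fun t ht => hg t (hsub ht)).trans (image_id' _)
  rw [h2, Real.coe_toNNReal _ hs.le, mul_one, hausdorffMeasure_real, Real.volume_Ioc] at h1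
  by_contra h0
  rw [nonpos_iff_eq_zero.1 (not_lt.1 h0), mul_zero, nonpos_iff_eq_zero,
    ENNReal.ofReal_eq_zero] at h1
  linarith

lemma hausdorffMeasure_ne_top (hγ : IsSnowflakeParametrization s c C γ E) : μH[s] E ≠ ⊤ := by
  rw [← hγ.image_eq]
  exact ((hγ.hausdorffMeasure_image_Icc_le le_rfl le_rfl).trans_lt ENNReal.ofReal_lt_top).ne

lemma dimH_eq (hγ : IsSnowflakeParametrization s c C γ E) : (dimH E).toReal = s := by
  have hs := hγ.exponent_pos
  have h1 : μH[((Real.toNNReal s : NNReal) : ℝ)] E ≠ 0 := by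
    rw [Real.coe_toNNReal _ hs.le]
    refine ((hγ.hausdorffMeasure_image_Ioc_pos le_rfl zero_lt_one le_rfl).trans_le ?_).ne'
    rw [← hγ.image_eq]
    exact measure_mono (image_mono Ioc_subset_Icc_self)
  have h2 : μH[((Real.toNNReal s : NNReal) : ℝ)] E ≠ ⊤ := by
    rw [Real.coe_toNNReal _ hs.le]
    exact hγ.hausdorffMeasure_ne_top
  rw [dimH_of_hausdorffMeasure_ne_zero_ne_top h1 h2]
  simp [hs.le]

/-- The measure function in terms of the parameter. -/
lemma measure_image_Icc_sub (hγ : IsSnowflakeParametrization s c C γ E) {a b : ℝ}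
    (ha : 0 ≤ a) (hab : a ≤ b) (hb : b ≤ 1) :
    (μH[s] (γ '' Icc 0 b)).toReal - (μH[s] (γ '' Icc 0 a)).toReal =
      (μH[s] (γ '' Ioc a b)).toReal := by
  have hfin : ∀ A ⊆ Icc (0 : ℝ) 1, μH[s] (γ '' A) ≠ ⊤ := fun A hA =>
    ne_top_of_le_ne_top hγ.hausdorffMeasure_ne_top
      (measure_mono (hγ.image_eq ▸ image_mono hA))
  have hu : γ '' Icc 0 b = γ '' Icc 0 a ∪ γ '' Ioc a b := by
    rw [← image_union, Icc_union_Ioc_eq_Icc ha hab]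
  have hdisj : Disjoint (γ '' Icc 0 a) (γ '' Ioc a b) := by
    rw [disjoint_left]
    rintro _ ⟨u, hu, rfl⟩ ⟨v, hv, he⟩
    have := hγ.injOn ⟨ha.trans hv.1.le, hv.2.trans hb⟩ ⟨hu.1, hu.2.trans (hab.trans hb)⟩ he
    linarith [hu.2, hv.1]
  have hmeas : MeasurableSet (γ '' Icc 0 a) :=
    (isCompact_Icc.image_of_continuousOn (hγ.continuousOn.mono
      (Icc_subset_Icc le_rfl (hab.trans hb)))).measurableSet
  rw [hu, measure_union' hdisj hmeas, ENNReal.toReal_add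
    (hfin _ (Icc_subset_Icc le_rfl (hab.trans hb)))
    (hfin _ fun t ht => ⟨ha.trans ht.1.le, ht.2.trans hb⟩)]
  ring

/-- The increment of the measure function from `γ a` to `γ b` is `H^s(γ (a, b])`. It is positive,
and at most `C * (b - a) ≤ C / c * |γ a - γ b| ^ s` with `s > 1`, so the extension theorem applies.
-/
theorem isStrictWhitneyFunctionOn (hγ : IsSnowflakeParametrization s c C γ E)
    (h : unitInterval ≃ₜ E) :
    IsStrictWhitneyFunctionOn E (hausdorffMeasureFunction h s (γ 0)) := by
  have hs := hγ.exponent_pos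
  have hC := hγ.C_pos
  have hc := hγ.c_pos
  have h01 : (0 : ℝ) ∈ Icc (0 : ℝ) 1 := ⟨le_rfl, zero_le_one⟩
  have h11 : (1 : ℝ) ∈ Icc (0 : ℝ) 1 := ⟨zero_le_one, le_rfl⟩
  obtain ⟨e, he⟩ := hγ.exists_homeomorph
  have hne : E.Nonempty := hγ.image_eq ▸ ⟨γ 0, mem_image_of_mem γ h01⟩
  set f : ℂ → ℝ := fun x => (μH[s] (subarc h (γ 0) x)).toReal with hf
  have hfγ : ∀ t ∈ Icc (0 : ℝ) 1, f (γ t) = (μH[s] (γ '' Icc 0 t)).toReal := by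
    intro t ht
    simp only [hf]
    rw [hγ.subarc_eq_image h h01 ht, uIcc_of_le ht.1]
  have hfsub : ∀ a ∈ Icc (0 : ℝ) 1, ∀ b ∈ Icc (0 : ℝ) 1, a ≤ b →
      f (γ b) - f (γ a) = (μH[s] (γ '' Ioc a b)).toReal := by
    intro a ha b hb hab
    rw [hfγ a ha, hfγ b hb, hγ.measure_image_Icc_sub ha.1 hab hb.2]
  have hlt : ∀ a ∈ Icc (0 : ℝ) 1, ∀ b ∈ Icc (0 : ℝ) 1, a < b → f (γ a) < f (γ b) := by
    intro a ha b hb hab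
    rw [← sub_pos, hfsub a ha b hb hab.le]
    refine ENNReal.toReal_pos (hγ.hausdorffMeasure_image_Ioc_pos ha.1 hab hb.2).ne' ?_
    refine ne_top_of_le_ne_top hγ.hausdorffMeasure_ne_top (measure_mono ?_)
    rw [← hγ.image_eq]
    exact image_mono fun t ht => ⟨ha.1.trans ht.1.le, ht.2.trans hb.2⟩
  have hle : ∀ a ∈ Icc (0 : ℝ) 1, ∀ b ∈ Icc (0 : ℝ) 1, a ≤ b →
      |f (γ a) - f (γ b)| ≤ C / c * dist (γ a) (γ b) ^ s := by
    intro a ha b hb hab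
    rw [abs_sub_comm, hfsub a ha b hb hab, abs_of_nonneg ENNReal.toReal_nonneg]
    have h1 : (μH[s] (γ '' Ioc a b)).toReal ≤ C * (b - a) := by
      refine ENNReal.toReal_le_of_le_ofReal (mul_nonneg hC.le (by linarith)) ?_
      exact (measure_mono (image_mono Ioc_subset_Icc_self)).trans
        (hγ.hausdorffMeasure_image_Icc_le ha.1 hb.2)
    have h2 := hγ.lower a ha b hb
    rw [abs_of_nonpos (by linarith)] at h2
    calc _ ≤ C * (b - a) := h1
      _ = C / c * (c * -(a - b)) := by field_simp; ring
      _ ≤ _ := mul_le_mul_of_nonneg_left h2 (by positivity)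
  have hholder : ∀ x ∈ E, ∀ y ∈ E, |f x - f y| ≤ C / c * dist x y ^ s := by
    intro x hx y hy
    obtain ⟨a, ha, rfl⟩ := hγ.image_eq.symm ▸ hx
    obtain ⟨b, hb, rfl⟩ := hγ.image_eq.symm ▸ hy
    rcases le_total a b with hab | hab
    · exact hle a ha b hb hab
    · rw [abs_sub_comm, dist_comm]
      exact hle b hb a ha hab
  obtain ⟨F, hF, hF0, hFf⟩ :=
    exists_contDiff_extension_of_holder hne hγ.one_lt (by positivity) hholder
  have hinj : ∀ a b : unitInterval, a < b → f (e a) ≠ f (e b) := by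
    intro a b hab
    rw [he, he]
    exact (hlt a a.2 b b.2 hab).ne
  refine ⟨⟨?_, ⟨F, hF, hF0, fun x => hFf x x.2⟩, e 0, e 1, hinj 0 1 zero_lt_one⟩, ?_⟩
  · rw [← hγ.image_eq]
    exact (isConnected_Icc zero_le_one).image γ hγ.continuousOn
  · intro U hU hUne
    have hV : IsOpen (e ⁻¹' U) := hU.preimage e.continuous
    have hVne : (e ⁻¹' U).Nonempty := hUne.preimage e.surjective
    obtain ⟨t, ht⟩ := hVne
    obtain ⟨a, ha, b, hb, hab⟩ := (infinite_of_mem_nhds t (hV.mem_nhds ht)).nontrivial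
    refine ⟨e a, ha, e b, hb, ?_⟩
    rcases lt_or_gt_of_ne hab with hlt | hlt
    · exact hinj a b hlt
    · exact (hinj b a hlt).symm

end IsSnowflakeParametrization

/-! ### Chains of intervals -/

/-- In a chain of non-overlapping intervals, each of which meets the next one, non-consecutive
intervals are disjoint. -/
lemma disjoint_of_chain_of_intervals {α : Type*} [LinearOrder α] {n : ℕ} {a b : ℕ → α}
    (hab : ∀ k < n, a k < b k)
    (hno : ∀ i < n, ∀ j < n, i ≠ j → b i ≤ a j ∨ b j ≤ a i)
    (hmeet : ∀ k, k + 1 < n → ∃ c, c ∈ Icc (a k) (b k) ∧ c ∈ Icc (a (k + 1)) (b (k + 1)))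
    {i j : ℕ} (hij : i + 1 < j) (hj : j < n) : Disjoint (Icc (a i) (b i)) (Icc (a j) (b j)) := by
  -- Intervals that meet without overlapping share an end point. The first pair fixes the direction
  -- of the chain.
  have hadj : ∀ k, k + 1 < n → b k = a (k + 1) ∨ b (k + 1) = a k := by
    intro k hk
    obtain ⟨c, ⟨h1, h2⟩, h3, h4⟩ := hmeet k hk
    rcases hno k (by omega) (k + 1) hk (by omega) with h | h
    · exact Or.inl (le_antisymm h (h3.trans h2))
    · exact Or.inr (le_antisymm h (h1.trans h4))
  rcases hadj 0 (by omega) with h0 | h0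
  · have hall : ∀ k, k + 1 < n → b k = a (k + 1) := by
      intro k
      induction k with
      | zero => exact fun _ => h0
      | succ k ih =>
        intro hk
        have e := ih (by omega)
        -- If the chain turned back, the intervals `k` and `k + 2` would have the same right end and
        -- overlap.
        refine (hadj (k + 1) hk).resolve_right fun he => ?_
        have h1 := hab k (by omega)
        have h2 := hab (k + 2) hk
        rw [← e] at he
        rcases hno k (by omega) (k + 2) hk (by omega) with h | h
        · exact absurd (h.trans_lt h2) (by rw [he]; exact lt_irrefl _)
        · exact absurd (h.trans_lt h1) (by rw [he]; exact lt_irrefl _)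
    have hmono : ∀ k, i + 1 ≤ k → k < n → a (i + 1) ≤ a k := by
      intro k hk
      induction k, hk using Nat.le_induction with
      | base => exact fun _ => le_rfl
      | succ k _ ih =>
        intro hk
        exact (ih (by omega)).trans ((hab k (by omega)).le.trans (hall k hk).le)
    have h1 : b i < a j := by
      have e := hall (j - 1) (by omega)
      rw [Nat.sub_add_cancel (by omega)] at e
      rw [hall i (by omega), ← e]
      exact (hmono (j - 1) (by omega) (by omega)).trans_lt (hab (j - 1) (by omega))
    rw [disjoint_left]
    exact fun x hx hx' => absurd (hx'.1.trans hx.2) (not_le.2 h1)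
  · have hall : ∀ k, k + 1 < n → b (k + 1) = a k := by
      intro k
      induction k with
      | zero => exact fun _ => h0
      | succ k ih =>
        intro hk
        have e := ih (by omega)
        refine (hadj (k + 1) hk).resolve_left fun he => ?_
        have h1 := hab k (by omega)
        have h2 := hab (k + 2) hk
        rw [e] at he
        rcases hno k (by omega) (k + 2) hk (by omega) with h | h
        · exact absurd (h1.trans_le h) (by rw [he]; exact lt_irrefl _)
        · exact absurd (h2.trans_le h) (by rw [he]; exact lt_irrefl _)
    have hmono : ∀ k, i + 1 ≤ k → k < n → b k ≤ b (i + 1) := by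
      intro k hk
      induction k, hk using Nat.le_induction with
      | base => exact fun _ => le_rfl
      | succ k _ ih =>
        intro hk
        exact ((hall k hk).le.trans (hab k (by omega)).le).trans (ih (by omega))
    have h1 : b j < a i := by
      have e := hall (j - 1) (by omega)
      rw [Nat.sub_add_cancel (by omega)] at e
      rw [← hall i (by omega), e]
      exact (hab (j - 1) (by omega)).trans_le (hmono (j - 1) (by omega) (by omega))
    rw [disjoint_left]
    exact fun x hx hx' => absurd (hx.1.trans hx'.2) (not_le.2 h1)

/-! ### Cones of adjacent triangles -/

/-- Two closed plane sectors with the same orientation of their sides and with disjoint interiors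
meet only at the vertex, unless the two inner or the two outer sides coincide. -/
lemma sectors_inter_trivial {ζ a b : ℂ} (hζ : 0 < ζ.im) (ha : a ≠ 0) (hb : b ≠ 0)
    (hopen : ∀ x y x' y' : ℝ, 0 < x → 0 < y → 0 < x' → 0 < y' →
      a * (-x + y * (ζ - 1)) ≠ b * (x' + y' * ζ))
    (houter : ∀ x x' : ℝ, 0 < x → 0 < x' → a * (-x) ≠ b * x')
    (hinner : ∀ y y' : ℝ, 0 < y → 0 < y' → a * (y * (ζ - 1)) ≠ b * (y' * ζ))
    {x y x' y' : ℝ} (hx : 0 ≤ x) (hy : 0 ≤ y) (hx' : 0 ≤ x') (hy' : 0 ≤ y')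
    (h : a * (-x + y * (ζ - 1)) = b * (x' + y' * ζ)) :
    (x = 0 ∧ y = 0) ∧ (x' = 0 ∧ y' = 0) := by
  have hev : ∀ p d : ℝ, 0 ≤ p → (p = 0 → 0 < d) → ∀ᶠ ε in 𝓝[>] (0 : ℝ), 0 < p + ε * d := by
    intro p d hp hd
    rcases hp.eq_or_lt with h0 | h0
    · filter_upwards [self_mem_nhdsWithin] with ε hε
      rw [← h0, zero_add]
      exact mul_pos hε (hd h0.symm)
    · have : Tendsto (fun ε : ℝ => p + ε * d) (𝓝[>] 0) (𝓝 p) := by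
        have h1 : Continuous fun ε : ℝ => p + ε * d := by fun_prop
        have h2 := h1.tendsto 0
        rw [zero_mul, add_zero] at h2
        exact h2.mono_left nhdsWithin_le_nhds
      exact this.eventually (lt_mem_nhds h0)
  -- A common point moved slightly along a common direction enters both open sectors if the
  -- direction increases every coordinate that vanishes. It remains to find such a direction for
  -- each position of a nonzero common point.
  have hperturb : ∀ m₁ m₂ n₁ n₂ : ℝ, a * (-m₁ + m₂ * (ζ - 1)) = b * (n₁ + n₂ * ζ) →
      (x = 0 → 0 < m₁) → (y = 0 → 0 < m₂) → (x' = 0 → 0 < n₁) → (y' = 0 → 0 < n₂) → False := by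
    intro m₁ m₂ n₁ n₂ he h1 h2 h3 h4
    obtain ⟨ε, ⟨e1, e2⟩, e3, e4⟩ := (((hev x m₁ hx h1).and (hev y m₂ hy h2)).and
      ((hev x' n₁ hx' h3).and (hev y' n₂ hy' h4))).exists
    refine hopen _ _ _ _ e1 e2 e3 e4 ?_
    push_cast
    linear_combination h + (ε : ℂ) * he
  have hdec : ∀ v : ℂ, ∃ n₁ n₂ : ℝ, v = n₁ + n₂ * ζ := by
    intro v
    refine ⟨v.re - v.im / ζ.im * ζ.re, v.im / ζ.im, ?_⟩
    apply Complex.ext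
    · simp
    · simp [hζ.ne']
  have hdec' : ∀ v : ℂ, ∃ m₁ m₂ : ℝ, v = -m₁ + m₂ * (ζ - 1) := by
    intro v
    obtain ⟨n₁, n₂, rfl⟩ := hdec v
    refine ⟨-n₁ - n₂, n₂, ?_⟩
    push_cast
    ring
  have hzero : x = 0 → y = 0 → x' = 0 ∧ y' = 0 := by
    rintro rfl rfl
    have h1 : (x' : ℂ) + y' * ζ = 0 := by
      have : b * ((x' : ℂ) + y' * ζ) = 0 := by rw [← h]; simp
      exact (mul_eq_zero.1 this).resolve_left hb
    have h2 := congrArg Complex.im h1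
    have h3 := congrArg Complex.re h1
    simp [hζ.ne'] at h2
    simp [h2] at h3
    exact ⟨h3, h2⟩
  have hzero' : x' = 0 → y' = 0 → x = 0 ∧ y = 0 := by
    rintro rfl rfl
    have h1 : -(x : ℂ) + y * (ζ - 1) = 0 := by
      have : a * (-(x : ℂ) + y * (ζ - 1)) = 0 := by rw [h]; simp
      exact (mul_eq_zero.1 this).resolve_left ha
    have h2 := congrArg Complex.im h1
    have h3 := congrArg Complex.re h1
    simp [hζ.ne'] at h2
    simp [h2] at h3
    exact ⟨h3, h2⟩
  by_contra hne
  have hxy : ¬ (x = 0 ∧ y = 0) := fun h0 => hne ⟨h0, hzero h0.1 h0.2⟩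
  have hxy' : ¬ (x' = 0 ∧ y' = 0) := fun h0 => hne ⟨hzero' h0.1 h0.2, h0⟩
  -- A point interior to one sector leaves the coordinates there unconstrained, so any direction
  -- into the other sector will do.
  by_cases hpos' : x' ≠ 0 ∧ y' ≠ 0
  · obtain ⟨n₁, n₂, hn⟩ := hdec (a * (-1 + (ζ - 1)) / b)
    refine hperturb 1 1 n₁ n₂ ?_ (fun _ => one_pos) (fun _ => one_pos)
      (fun h0 => absurd h0 hpos'.1) (fun h0 => absurd h0 hpos'.2)
    rw [← hn]
    push_cast
    field_simp
  by_cases hpos : x ≠ 0 ∧ y ≠ 0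
  · obtain ⟨m₁, m₂, hm⟩ := hdec' (b * (1 + ζ) / a)
    refine hperturb m₁ m₂ 1 1 ?_ (fun h0 => absurd h0 hpos.1) (fun h0 => absurd h0 hpos.2)
      (fun _ => one_pos) (fun _ => one_pos)
    rw [← hm]
    push_cast
    field_simp
  -- Now the point is on a side of each sector. Two outer or two inner sides are excluded by
  -- hypothesis. If an outer side falls on an inner one, the orientation puts both sectors on the
  -- same side of it, and this identity yields the direction.
  have hconj : ζ * ζ = 2 * ζ.re * ζ - (ζ.re ^ 2 + ζ.im ^ 2 : ℝ) := by
    apply Complex.ext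
    · simp [pow_two]; ring
    · simp [pow_two]; ring
  by_cases hy0 : y = 0
  · have hx0 : x ≠ 0 := fun h0 => hxy ⟨h0, hy0⟩
    by_cases hy0' : y' = 0
    · have hx0' : x' ≠ 0 := fun h0 => hxy' ⟨h0, hy0'⟩
      refine houter x x' (hx.lt_of_ne' hx0) (hx'.lt_of_ne' hx0') ?_
      simpa [hy0, hy0'] using h
    · have hx0' : x' = 0 := by
        by_contra h0
        exact hpos' ⟨h0, hy0'⟩
      have hxp := hx.lt_of_ne' hx0
      have hyp := hy'.lt_of_ne' hy0'
      have hxc : (x : ℂ) ≠ 0 := by exact_mod_cast hx0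
      -- The direction is `a * (ζ - 1)`. Substituting `a = -b * y' * ζ / x` gives its coordinates,
      -- the first being `y' / x * |ζ| ^ 2 > 0`.
      refine hperturb 0 1 (y' / x * (ζ.re ^ 2 + ζ.im ^ 2)) (-(y' / x) * (2 * ζ.re - 1)) ?_
        (fun h0 => absurd h0 hx0) (fun _ => one_pos) (fun _ => by positivity)
        (fun h0 => absurd h0 hy0')
      have h' : a * (-x) = b * (y' * ζ) := by simpa [hy0, hx0'] using h
      have ha' : a = -(b * (y' * ζ)) / x := by
        field_simp
        linear_combination -h'
      rw [ha']
      push_cast at hconj ⊢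
      field_simp
      linear_combination (-(y' : ℂ)) * hconj
  · have hx0 : x = 0 := by
      by_contra h0
      exact hpos ⟨h0, hy0⟩
    by_cases hx0' : x' = 0
    · have hy0' : y' ≠ 0 := fun h0 => hxy' ⟨hx0', h0⟩
      refine hinner y y' (hy.lt_of_ne' hy0) (hy'.lt_of_ne' hy0') ?_
      simpa [hx0, hx0'] using h
    · have hy0' : y' = 0 := by
        by_contra h0
        exact hpos' ⟨hx0', h0⟩
      have hyp := hy.lt_of_ne' hy0
      have hxp := hx'.lt_of_ne' hx0'
      have hxc : (x' : ℂ) ≠ 0 := by exact_mod_cast hx0'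
      have hyc : (y : ℂ) ≠ 0 := by exact_mod_cast hy0
      have hN : 0 < (ζ.re - 1) ^ 2 + ζ.im ^ 2 := by positivity
      have hNc : (((ζ.re - 1) ^ 2 + ζ.im ^ 2 : ℝ) : ℂ) ≠ 0 := by exact_mod_cast hN.ne'
      set N : ℝ := (ζ.re - 1) ^ 2 + ζ.im ^ 2 with hNdef
      -- The direction is `-a`. Dividing by `ζ - 1` brings in `N = |ζ - 1| ^ 2`, and the second
      -- coordinate is positive.
      refine hperturb 1 0 (x' / (y * N) * (1 - 2 * ζ.re)) (x' / (y * N)) ?_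
        (fun _ => one_pos) (fun h0 => absurd h0 hy0) (fun h0 => absurd h0 hx0')
        (fun _ => by positivity)
      have h' : a * (y * (ζ - 1)) = b * x' := by simpa [hx0, hy0'] using h
      have hb' : b = a * (y * (ζ - 1)) / x' := by
        field_simp
        linear_combination -h'
      have hN' : (N : ℂ) = -((ζ - 1) * (ζ - 2 * ζ.re + 1)) := by
        rw [hNdef]
        push_cast at hconj ⊢
        linear_combination hconj
      rw [hb']
      push_cast
      field_simp
      linear_combination (-1 : ℂ) * hN'

/-- Sectors that meet only at the vertex are separated by an angle. -/
lemma exists_sector_separation {ζ a b : ℂ}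
    (hinter : ∀ x y x' y' : ℝ, 0 ≤ x → 0 ≤ y → 0 ≤ x' → 0 ≤ y' →
      a * (-x + y * (ζ - 1)) = b * (x' + y' * ζ) → (x = 0 ∧ y = 0) ∧ (x' = 0 ∧ y' = 0)) :
    ∃ K : ℝ, 0 ≤ K ∧ ∀ x y x' y' : ℝ, 0 ≤ x → 0 ≤ y → 0 ≤ x' → 0 ≤ y' →
      ‖a * (-x + y * (ζ - 1))‖ ≤ K * ‖a * (-x + y * (ζ - 1)) - b * (x' + y' * ζ)‖ := by
  -- Both sides are homogeneous in the four coordinates, so a positive minimum on the compact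
  -- simplex suffices.
  let Φ : (Fin 4 → ℝ) → ℝ := fun v =>
    ‖a * (-(v 0) + v 1 * (ζ - 1)) - b * (v 2 + v 3 * ζ)‖
  obtain ⟨m, hm, hle⟩ := (isCompact_stdSimplex ℝ (Fin 4)).exists_forall_le' (f := Φ) (a := 0)
    (by fun_prop) (by
      intro v hv
      rw [norm_pos_iff, sub_ne_zero]
      intro he
      obtain ⟨⟨h0, h1⟩, h2, h3⟩ := hinter _ _ _ _ (hv.1 0) (hv.1 1) (hv.1 2) (hv.1 3) he
      have := hv.2
      simp [Fin.sum_univ_four, h0, h1, h2, h3] at this)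
  set M : ℝ := ‖a‖ * (1 + ‖ζ - 1‖) with hM
  have hM0 : 0 ≤ M := by positivity
  refine ⟨M / m, by positivity, fun x y x' y' hx hy hx' hy' => ?_⟩
  have h1 : ‖a * (-x + y * (ζ - 1))‖ ≤ M * (x + y) := by
    rw [norm_mul, hM, mul_assoc]
    apply mul_le_mul_of_nonneg_left _ (norm_nonneg _)
    refine (norm_add_le _ _).trans ?_
    rw [norm_neg, norm_mul, Complex.norm_real, Complex.norm_real, Real.norm_of_nonneg hx,
      Real.norm_of_nonneg hy]
    nlinarith [norm_nonneg (ζ - 1)]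
  set S : ℝ := x + y + x' + y' with hS
  have hS0 : 0 ≤ S := by positivity
  have h2 : m * S ≤ ‖a * (-x + y * (ζ - 1)) - b * (x' + y' * ζ)‖ := by
    rcases hS0.eq_or_lt with h0 | h0
    · rw [← h0, mul_zero]; exact norm_nonneg _
    · have := hle ![x / S, y / S, x' / S, y' / S] ⟨by
        intro i
        fin_cases i <;> simp <;> positivity, by
        simp [Fin.sum_univ_four]
        field_simp
        rw [hS]⟩
      have hSc : (S : ℂ) ≠ 0 := by exact_mod_cast h0.ne'
      have e : a * (-x + y * (ζ - 1)) - b * (x' + y' * ζ) =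
          S * (a * (-((x / S : ℝ) : ℂ) + (y / S : ℝ) * (ζ - 1)) -
            b * ((x' / S : ℝ) + (y' / S : ℝ) * ζ)) := by
        push_cast
        field_simp
      rw [e, norm_mul, Complex.norm_real, Real.norm_of_nonneg hS0, mul_comm]
      exact mul_le_mul_of_nonneg_left this hS0
  calc ‖a * (-x + y * (ζ - 1))‖ ≤ M * (x + y) := h1
    _ ≤ M * S := mul_le_mul_of_nonneg_left (by rw [hS]; linarith) hM0
    _ = M / m * (m * S) := by field_simp
    _ ≤ _ := mul_le_mul_of_nonneg_left h2 (by positivity)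

/-! ### The basic triangle -/

lemma Convex.three_point_mem {K : Set ℂ} (hK : Convex ℝ K) {u v w : ℂ} (hu : u ∈ K) (hv : v ∈ K)
    (hw : w ∈ K) {x y : ℝ} (hx : 0 ≤ x) (hy : 0 ≤ y) (hxy : x + y ≤ 1) :
    u + x * (v - u) + y * (w - u) ∈ K := by
  have := hK.sum_mem (t := Finset.univ) (w := ![1 - x - y, x, y]) (z := ![u, v, w])
    (by intro i _; fin_cases i <;> simp <;> linarith)
    (by simp [Fin.sum_univ_three]; ring)
    (by intro i _; fin_cases i <;> simp [hu, hv, hw])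
  simp only [Fin.sum_univ_three, Matrix.cons_val_zero, Matrix.cons_val_one, Matrix.cons_val_two,
    Matrix.tail_cons, Matrix.head_cons, Complex.real_smul] at this
  convert this using 1
  push_cast
  ring

/-- The normalizing coordinate that takes `z 0` to `0` and `z ℓ` to `1`. -/
def normCoord (ℓ : ℕ) (z : ℕ → ℂ) (w : ℂ) : ℂ := (w - z 0) / (z ℓ - z 0)

lemma figureMap_eq (ℓ : ℕ) (z : ℕ → ℂ) (j : ℕ) (w : ℂ) :
    figureMap ℓ z j w = z (j - 1) + (z j - z (j - 1)) * normCoord ℓ z w := by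
  rw [figureMap, normCoord]
  ring

lemma dist_figureMap (ℓ : ℕ) (z : ℕ → ℂ) (j : ℕ) (u v : ℂ) :
    dist (figureMap ℓ z j u) (figureMap ℓ z j v) =
      ‖(z j - z (j - 1)) / (z ℓ - z 0)‖ * dist u v := by
  rw [dist_eq_norm, dist_eq_norm, ← norm_mul, figureMap, figureMap]
  congr 1
  ring

namespace IsBasicFigure

variable {ℓ q : ℕ} {z : ℕ → ℂ}

lemma base_ne (h : IsBasicFigure ℓ q z) : z ℓ - z 0 ≠ 0 := by
  intro h0
  have := h.orientation
  simp [h0] at this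

lemma apex_im_pos (h : IsBasicFigure ℓ q z) : 0 < (normCoord ℓ z (z q)).im := h.orientation

lemma eq_of_normCoord (h : IsBasicFigure ℓ q z) {w v : ℂ} (hw : normCoord ℓ z w = v) :
    w = z 0 + v * (z ℓ - z 0) := by
  rw [← hw, normCoord, div_mul_cancel₀ _ h.base_ne]
  ring

lemma normCoord_combination (h : IsBasicFigure ℓ q z) (v : ℂ) :
    normCoord ℓ z (z 0 + v * (z ℓ - z 0)) = v := by
  rw [normCoord, add_sub_cancel_left, mul_div_cancel_right₀ _ h.base_ne]

lemma continuous_normCoord (ℓ : ℕ) (z : ℕ → ℂ) : Continuous (normCoord ℓ z) := by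
  unfold normCoord
  fun_prop

lemma mem_hull_iff (h : IsBasicFigure ℓ q z) {w : ℂ} :
    w ∈ convexHull ℝ {z 0, z ℓ, z q} ↔ ∃ x y : ℝ, 0 ≤ x ∧ 0 ≤ y ∧ x + y ≤ 1 ∧
      normCoord ℓ z w = x + y * normCoord ℓ z (z q) := by
  constructor
  · intro hw
    have hsub : convexHull ℝ {z 0, z ℓ, z q} ⊆ {w | ∃ x y : ℝ, 0 ≤ x ∧ 0 ≤ y ∧ x + y ≤ 1 ∧
        normCoord ℓ z w = x + y * normCoord ℓ z (z q)} := by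
      apply convexHull_min
      · rintro w (rfl | rfl | rfl)
        · exact ⟨0, 0, le_rfl, le_rfl, by norm_num, by simp [normCoord]⟩
        · exact ⟨1, 0, zero_le_one, le_rfl, by norm_num, by simp [normCoord, h.base_ne]⟩
        · exact ⟨0, 1, le_rfl, zero_le_one, by norm_num, by simp⟩
      · rintro w₁ ⟨x₁, y₁, hx₁, hy₁, hs₁, e₁⟩ w₂ ⟨x₂, y₂, hx₂, hy₂, hs₂, e₂⟩ a b ha hb hab
        refine ⟨a * x₁ + b * x₂, a * y₁ + b * y₂, by positivity, by positivity, ?_, ?_⟩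
        · nlinarith
        · have hab' : (a : ℂ) + b = 1 := by exact_mod_cast hab
          have : normCoord ℓ z (a • w₁ + b • w₂) =
              a * normCoord ℓ z w₁ + b * normCoord ℓ z w₂ := by
            simp only [normCoord, Complex.real_smul]
            rw [← mul_div_assoc, ← mul_div_assoc, ← add_div]
            congr 1
            linear_combination (z 0) * hab'
          rw [this, e₁, e₂]
          push_cast
          ring
    exact hsub hw
  · rintro ⟨x, y, hx, hy, hxy, e⟩
    rw [h.eq_of_normCoord e]
    have := (convex_convexHull ℝ {z 0, z ℓ, z q}).three_point_mem
      (subset_convexHull ℝ _ (by simp : z 0 ∈ ({z 0, z ℓ, z q} : Set ℂ)))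
      (subset_convexHull ℝ _ (by simp : z ℓ ∈ ({z 0, z ℓ, z q} : Set ℂ)))
      (subset_convexHull ℝ _ (by simp : z q ∈ ({z 0, z ℓ, z q} : Set ℂ))) hx hy hxy
    convert this using 1
    rw [normCoord, add_mul, mul_assoc, div_mul_cancel₀ _ h.base_ne]
    ring

lemma mem_openTriangle (h : IsBasicFigure ℓ q z) {w : ℂ} {x y : ℝ} (hx : 0 < x) (hy : 0 < y)
    (hxy : x + y < 1) (e : normCoord ℓ z w = x + y * normCoord ℓ z (z q)) :
    w ∈ openTriangle ℓ q z := by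
  set ζ := normCoord ℓ z (z q) with hζ
  have hζ0 : 0 < ζ.im := h.apex_im_pos
  -- `X` and `Y` are the continuous coordinates in the real basis `1, ζ`, so strict inequalities
  -- between them cut out an open set.
  let Y : ℂ → ℝ := fun w => (normCoord ℓ z w).im / ζ.im
  let X : ℂ → ℝ := fun w => (normCoord ℓ z w).re - Y w * ζ.re
  have hN := continuous_normCoord ℓ z
  have hYc : Continuous Y := (Complex.continuous_im.comp hN).div_const _
  have hXc : Continuous X := (Complex.continuous_re.comp hN).sub (hYc.mul continuous_const)
  have hdec : ∀ w, normCoord ℓ z w = X w + Y w * ζ := by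
    intro w
    apply Complex.ext
    · simp [X]
    · simp [X, Y, hζ0.ne']
  have hY : Y w = y := by simp [Y, e, hζ0.ne']
  have hX : X w = x := by simp [X, hY, e]
  have hopen : IsOpen {w | (0 < X w ∧ 0 < Y w) ∧ X w + Y w < 1} :=
    ((isOpen_lt continuous_const hXc).inter (isOpen_lt continuous_const hYc)).inter
      (isOpen_lt (hXc.add hYc) continuous_const)
  refine interior_maximal ?_ hopen ⟨⟨by rw [hX]; exact hx, by rw [hY]; exact hy⟩,
    by rw [hX, hY]; exact hxy⟩
  rintro v ⟨⟨h1, h2⟩, h3⟩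
  exact h.mem_hull_iff.2 ⟨X v, Y v, h1.le, h2.le, h3.le, hdec v⟩

lemma isOpen_openTriangle (ℓ q : ℕ) (z : ℕ → ℂ) : IsOpen (openTriangle ℓ q z) := isOpen_interior

lemma openTriangle_subset_hull (ℓ q : ℕ) (z : ℕ → ℂ) :
    openTriangle ℓ q z ⊆ convexHull ℝ {z 0, z ℓ, z q} := interior_subset

lemma isClosed_hull (ℓ q : ℕ) (z : ℕ → ℂ) : IsClosed (convexHull ℝ {z 0, z ℓ, z q}) :=
  (Set.Finite.isCompact_convexHull ℝ (Set.toFinite _)).isClosed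

lemma closedTriangle_eq (h : IsBasicFigure ℓ q z) :
    closedTriangle ℓ q z = convexHull ℝ {z 0, z ℓ, z q} := by
  have hne : (openTriangle ℓ q z).Nonempty :=
    ⟨_, h.mem_openTriangle (x := 1 / 3) (y := 1 / 3) (by norm_num) (by norm_num) (by norm_num)
      (h.normCoord_combination _)⟩
  rw [closedTriangle, openTriangle,
    (convex_convexHull ℝ _).closure_interior_eq_closure_of_nonempty_interior hne]
  exact (isClosed_hull ℓ q z).closure_eq

lemma ratio_ne (h : IsBasicFigure ℓ q z) {j : ℕ} (hj : 1 ≤ j) (hj' : j ≤ ℓ) :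
    z j - z (j - 1) ≠ 0 := by
  intro h0
  have := (h.contractive j hj hj').1
  simp [h0] at this

lemma vertex_mem_hull (h : IsBasicFigure ℓ q z) {j : ℕ} (hj : j ≤ ℓ) :
    z j ∈ convexHull ℝ {z 0, z ℓ, z q} := by
  rcases h.vertex_mem j hj with (h1 | h1) | h1
  · rw [h1]
    exact subset_convexHull ℝ _ (by simp)
  · exact segment_subset_convexHull (by simp) (by simp) h1
  · exact openTriangle_subset_hull ℓ q z h1

/-- By convexity only the images of the three vertices matter: two vertices of the polygon and the
image of the apex. -/
lemma figureMap_mem_hull (h : IsBasicFigure ℓ q z) {j : ℕ} (hj : 1 ≤ j) (hj' : j ≤ ℓ) {w : ℂ}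
    (hw : w ∈ convexHull ℝ {z 0, z ℓ, z q}) :
    figureMap ℓ z j w ∈ convexHull ℝ {z 0, z ℓ, z q} := by
  obtain ⟨x, y, hx, hy, hxy, e⟩ := h.mem_hull_iff.1 hw
  have hq := h.apex_mem j hj hj'
  rw [h.closedTriangle_eq] at hq
  have := (convex_convexHull ℝ {z 0, z ℓ, z q}).three_point_mem
    (h.vertex_mem_hull ((Nat.sub_le j 1).trans hj')) (h.vertex_mem_hull hj') hq hx hy hxy
  convert this using 1
  rw [figureMap_eq, figureMap_eq, e]
  ring

lemma isOpenMap_figureMap (h : IsBasicFigure ℓ q z) {j : ℕ} (hj : 1 ≤ j) (hj' : j ≤ ℓ) :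
    IsOpenMap (figureMap ℓ z j) := by
  have ha : (z j - z (j - 1)) / (z ℓ - z 0) ≠ 0 := div_ne_zero (h.ratio_ne hj hj') h.base_ne
  exact ((Homeomorph.subRight (z 0)).trans ((Homeomorph.mulLeft₀ _ ha).trans
    (Homeomorph.addRight (z (j - 1))))).isOpenMap

lemma figureMap_mem_openTriangle (h : IsBasicFigure ℓ q z) {j : ℕ} (hj : 1 ≤ j) (hj' : j ≤ ℓ)
    {w : ℂ} (hw : w ∈ openTriangle ℓ q z) : figureMap ℓ z j w ∈ openTriangle ℓ q z := by
  refine interior_maximal (s := convexHull ℝ {z 0, z ℓ, z q}) ?_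
    (h.isOpenMap_figureMap hj hj' _ (isOpen_openTriangle ℓ q z)) (mem_image_of_mem _ hw)
  rintro _ ⟨v, hv, rfl⟩
  exact h.figureMap_mem_hull hj hj' (openTriangle_subset_hull ℓ q z hv)

lemma figureMap_first (ℓ : ℕ) (z : ℕ → ℂ) (j : ℕ) : figureMap ℓ z j (z 0) = z (j - 1) := by
  simp [figureMap]

lemma figureMap_last (h : IsBasicFigure ℓ q z) (j : ℕ) : figureMap ℓ z j (z ℓ) = z j := by
  rw [figureMap, div_mul_cancel₀ _ h.base_ne, sub_add_cancel]

lemma one_le (h : IsBasicFigure ℓ q z) : 1 ≤ ℓ := by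
  rcases Nat.eq_zero_or_pos ℓ with rfl | h0
  · exact absurd (sub_self _) h.base_ne
  · exact h0

/-- The polygon is longer than its base. -/
lemma one_lt_sum_ratio (h : IsBasicFigure ℓ q z) :
    1 < ∑ j ∈ Finset.range ℓ, ‖(z (j + 1) - z j) / (z ℓ - z 0)‖ := by
  have hpos : 0 < ‖z ℓ - z 0‖ := norm_pos_iff.2 h.base_ne
  -- The polygon passes through the apex, so it is at least as long as the two upper sides of the
  -- triangle. Equality of these with the base would put the apex on the base.
  have h1 : dist (z 0) (z q) + dist (z q) (z ℓ) ≤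
      ∑ j ∈ Finset.range ℓ, dist (z j) (z (j + 1)) := by
    rw [Finset.range_eq_Ico, ← Finset.sum_Ico_consecutive _ (Nat.zero_le q) h.q_le]
    exact add_le_add (dist_le_Ico_sum_dist z (Nat.zero_le q)) (dist_le_Ico_sum_dist z h.q_le)
  have h2 : dist (z 0) (z ℓ) < dist (z 0) (z q) + dist (z q) (z ℓ) := by
    refine lt_of_le_of_ne (dist_triangle _ _ _) fun he => ?_
    have hb := dist_add_dist_eq_iff.1 he.symm
    obtain ⟨t, -, ht⟩ := hb
    have h3 := h.orientation
    rw [← ht, AffineMap.lineMap_apply] at h3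
    simp only [vsub_eq_sub, vadd_eq_add, add_sub_cancel_right, Complex.real_smul] at h3
    rw [mul_div_cancel_right₀ _ h.base_ne, Complex.ofReal_im] at h3
    exact lt_irrefl _ h3
  have h3 : ∑ j ∈ Finset.range ℓ, ‖(z (j + 1) - z j) / (z ℓ - z 0)‖ =
      (∑ j ∈ Finset.range ℓ, dist (z j) (z (j + 1))) / ‖z ℓ - z 0‖ := by
    rw [Finset.sum_div]
    refine Finset.sum_congr rfl fun j _ => ?_
    rw [norm_div, dist_comm, dist_eq_norm]
  rw [h3, one_lt_div hpos, ← dist_eq_norm, dist_comm]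
  linarith

/-- The triangles at the two sides of an inner vertex are separated by an angle if the corner
angle is positive. -/
lemma exists_separation (h : IsBasicFigure ℓ q z) {i : ℕ} (hi : 1 ≤ i) (hiℓ : i < ℓ)
    (hθ : 0 < cornerAngle ℓ q z i) :
    ∃ K : ℝ, 0 ≤ K ∧ ∀ u ∈ convexHull ℝ {z 0, z ℓ, z q}, ∀ v ∈ convexHull ℝ {z 0, z ℓ, z q},
      dist (figureMap ℓ z i u) (z i) ≤
        K * dist (figureMap ℓ z i u) (figureMap ℓ z (i + 1) v) := by
  set ζ := normCoord ℓ z (z q) with hζ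
  have hζ0 : 0 < ζ.im := h.apex_im_pos
  set a := z i - z (i - 1) with ha
  set b := z (i + 1) - z i with hb
  have ha0 : a ≠ 0 := h.ratio_ne hi hiℓ.le
  have hb0 : b ≠ 0 := h.ratio_ne (j := i + 1) (by omega) hiℓ
  have hleft : ∀ w, figureMap ℓ z i w = z i + a * (normCoord ℓ z w - 1) := by
    intro w
    rw [figureMap_eq, ha]
    ring
  have hright : ∀ w, figureMap ℓ z (i + 1) w = z i + b * normCoord ℓ z w := by
    intro w
    rw [figureMap_eq, hb, Nat.add_sub_cancel]
  have hopen : ∀ x y x' y' : ℝ, 0 < x → 0 < y → 0 < x' → 0 < y' →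
      a * (-x + y * (ζ - 1)) ≠ b * (x' + y' * ζ) := by
    intro x y x' y' hx hy hx' hy' he
    -- Shrinking a common vector of the open sectors by `ε` puts it in both small open triangles,
    -- which are disjoint.
    set ε : ℝ := 1 / (x + y + x' + y' + 1) with hε
    have hS : 0 < x + y + x' + y' + 1 := by positivity
    have hε0 : 0 < ε := by positivity
    have hεS : ε * (x + y + x' + y' + 1) = 1 := one_div_mul_cancel hS.ne'
    have hεx := mul_pos hε0 hx
    have hεy := mul_pos hε0 hy
    have hεx' := mul_pos hε0 hx'
    have hεy' := mul_pos hε0 hy'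
    have m1 := h.mem_openTriangle (x := 1 - ε * x - ε * y) (y := ε * y) (by nlinarith) hεy
      (by nlinarith) (h.normCoord_combination _)
    have m2 := h.mem_openTriangle (x := ε * x') (y := ε * y') hεx' hεy'
      (by nlinarith) (h.normCoord_combination _)
    refine disjoint_left.1 (h.disjoint i (i + 1) hi hiℓ.le (by omega) hiℓ (by omega))
      (mem_image_of_mem _ m1) ⟨_, m2, ?_⟩
    rw [hleft, hright, h.normCoord_combination, h.normCoord_combination]
    push_cast
    linear_combination (-(ε : ℂ)) * he
  have houter : ∀ x x' : ℝ, 0 < x → 0 < x' → a * (-x) ≠ b * x' := by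
    intro x x' hx hx' he
    -- Outer sides in the same direction would give consecutive segments a common point other than
    -- `z i`; `τ` makes it fall inside both.
    set τ : ℝ := 1 / (x + x') with hτ
    have hS : 0 < x + x' := by positivity
    have hτ0 : 0 < τ := by positivity
    have hτS : τ * (x + x') = 1 := one_div_mul_cancel hS.ne'
    have hτx := mul_pos hτ0 hx
    have hτx' := mul_pos hτ0 hx'
    have hmem : z i + b * ((τ * x' : ℝ) : ℂ) ∈
        segment ℝ (z (i - 1)) (z i) ∩ segment ℝ (z i) (z (i + 1)) := by
      constructor
      · refine ⟨τ * x, 1 - τ * x, hτx.le, by nlinarith, by ring, ?_⟩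
        simp only [Complex.real_smul]
        push_cast
        rw [ha] at he
        linear_combination (τ : ℂ) * he
      · refine ⟨1 - τ * x', τ * x', by nlinarith, hτx'.le, by ring, ?_⟩
        simp only [Complex.real_smul, hb]
        push_cast
        ring
    rw [h.polygon i hi hiℓ, mem_singleton_iff, add_eq_left, mul_eq_zero] at hmem
    rcases hmem with h0 | h0
    · exact hb0 h0
    · exact hτx'.ne' (by exact_mod_cast h0)
  have hinner : ∀ y y' : ℝ, 0 < y → 0 < y' → a * (y * (ζ - 1)) ≠ b * (y' * ζ) := by
    intro y y' hy hy' he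
    -- If the inner sides coincide, the quotient defining the corner angle is a positive real, of
    -- argument 0.
    refine hθ.ne' ?_
    have hζne : ζ ≠ 0 := by
      intro h0
      rw [h0, Complex.zero_im] at hζ0
      exact lt_irrefl _ hζ0
    have hyc : (y : ℂ) ≠ 0 := by exact_mod_cast hy.ne'
    have : (figureMap ℓ z i (z q) - z i) / (figureMap ℓ z (i + 1) (z q) - z i) =
        ((y' / y : ℝ) : ℂ) := by
      rw [hleft, hright, add_sub_cancel_left, add_sub_cancel_left, ← hζ,
        div_eq_iff (mul_ne_zero hb0 hζne)]
      push_cast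
      field_simp
      linear_combination he
    rw [cornerAngle, this, posArg, Complex.arg_ofReal_of_nonneg (by positivity)]
    exact toIcoMod_apply_left _ _
  obtain ⟨K, hK0, hK⟩ := exists_sector_separation (ζ := ζ) (a := a) (b := b)
    fun x y x' y' hx hy hx' hy' he =>
      sectors_inter_trivial hζ0 ha0 hb0 hopen houter hinner hx hy hx' hy' he
  refine ⟨K, hK0, fun u hu v hv => ?_⟩
  obtain ⟨x, y, hx, hy, hxy, eu⟩ := h.mem_hull_iff.1 hu
  obtain ⟨x', y', hx', hy', hxy', ev⟩ := h.mem_hull_iff.1 hv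
  have := hK (1 - x - y) y x' y' (by linarith) hy hx' hy'
  have e1 : a * (normCoord ℓ z u - 1) = a * (-((1 - x - y : ℝ) : ℂ) + y * (ζ - 1)) := by
    rw [eu]
    push_cast
    ring
  rw [dist_eq_norm, dist_eq_norm, hleft, hright, add_sub_cancel_left, add_sub_add_left_eq_sub,
    e1, ev]
  exact this

end IsBasicFigure

/-! ### The arc -/

namespace IsRegularSelfSimilarArc

variable {ℓ q : ℕ} {z : ℕ → ℂ} {Λ : Set ℂ}

lemma map_mem (hΛ : IsRegularSelfSimilarArc ℓ q z Λ) {j : ℕ} (hj : 1 ≤ j) (hj' : j ≤ ℓ) {w : ℂ}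
    (hw : w ∈ Λ) : figureMap ℓ z j w ∈ Λ := by
  rw [hΛ.selfSimilar]
  exact mem_biUnion (show j ∈ Icc 1 ℓ from ⟨hj, hj'⟩) (mem_image_of_mem _ hw)

/-- The map takes the point of `Λ` nearest to the fixed point strictly closer, unless that distance
is zero. -/
lemma fixed_point_mem (hΛ : IsRegularSelfSimilarArc ℓ q z Λ) {j : ℕ} (hj : 1 ≤ j) (hj' : j ≤ ℓ)
    {v : ℂ} (hv : figureMap ℓ z j v = v) : v ∈ Λ := by
  obtain ⟨x, hx, hmin⟩ := hΛ.isCompact.exists_isMinOn hΛ.nonempty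
    (f := fun x => dist x v) (by fun_prop)
  have h1 : dist x v ≤ dist (figureMap ℓ z j x) v := hmin (hΛ.map_mem hj hj' hx)
  have h2 := dist_figureMap ℓ z j x v
  rw [hv] at h2
  have h3 := (hΛ.basicFigure.contractive j hj hj').2
  have h4 : dist x v = 0 := by nlinarith [dist_nonneg (x := x) (y := v)]
  rwa [← dist_eq_zero.1 h4]

lemma first_mem (hΛ : IsRegularSelfSimilarArc ℓ q z Λ) : z 0 ∈ Λ :=
  hΛ.fixed_point_mem le_rfl hΛ.basicFigure.one_le (IsBasicFigure.figureMap_first ℓ z 1)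

lemma last_mem (hΛ : IsRegularSelfSimilarArc ℓ q z Λ) : z ℓ ∈ Λ :=
  hΛ.fixed_point_mem hΛ.basicFigure.one_le le_rfl (hΛ.basicFigure.figureMap_last ℓ)

lemma vertex_mem (hΛ : IsRegularSelfSimilarArc ℓ q z Λ) {j : ℕ} (hj : j ≤ ℓ) : z j ∈ Λ := by
  rcases Nat.eq_zero_or_pos j with rfl | h0
  · exact hΛ.first_mem
  · rw [← hΛ.basicFigure.figureMap_last j]
    exact hΛ.map_mem h0 hj hΛ.last_mem

/-- Chains are numbered from 0, so `T j` is `S_{j+1}`. -/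
lemma isSimilarityChain (hΛ : IsRegularSelfSimilarArc ℓ q z Λ) :
    IsSimilarityChain ℓ z (fun j => figureMap ℓ z (j + 1))
      (fun j => ‖(z (j + 1) - z j) / (z ℓ - z 0)‖) Λ where
  ratio_pos j hj := (hΛ.basicFigure.contractive (j + 1) (by omega) hj).1
  ratio_lt_one j hj := (hΛ.basicFigure.contractive (j + 1) (by omega) hj).2
  dist_map j _ x y := dist_figureMap ℓ z (j + 1) x y
  map_first j _ := IsBasicFigure.figureMap_first ℓ z (j + 1)
  map_last j _ := hΛ.basicFigure.figureMap_last (j + 1)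
  isCompact := hΛ.isCompact
  first_mem := hΛ.first_mem
  mapsTo j hj x hx := hΛ.map_mem (by omega) hj hx
  exists_preimage x hx := by
    rw [hΛ.selfSimilar] at hx
    simp only [mem_iUnion, mem_Icc] at hx
    obtain ⟨j, ⟨hj, hj'⟩, y, hy, rfl⟩ := hx
    exact ⟨j - 1, by omega, y, hy, by rw [Nat.sub_add_cancel hj]⟩

/-- The part of `Λ` in the closed triangle is invariant and contains `z 0`, so it is dense in `Λ`.
-/
lemma subset_hull (hΛ : IsRegularSelfSimilarArc ℓ q z Λ) :
    Λ ⊆ convexHull ℝ {z 0, z ℓ, z q} := by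
  have h := hΛ.isSimilarityChain.subset_closure
    (A := Λ ∩ convexHull ℝ {z 0, z ℓ, z q}) inter_subset_left
    ⟨z 0, hΛ.first_mem, subset_convexHull ℝ _ (by simp)⟩
    (fun j hj x hx => ⟨hΛ.map_mem (by omega) hj hx.1,
      hΛ.basicFigure.figureMap_mem_hull (by omega) hj hx.2⟩)
  exact h.trans (closure_minimal inter_subset_right (IsBasicFigure.isClosed_hull ℓ q z))

lemma isPreconnected (hΛ : IsRegularSelfSimilarArc ℓ q z Λ) : IsPreconnected Λ := by
  obtain ⟨h⟩ := hΛ.isArc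
  have : Λ = range fun t => (h t : ℂ) := by
    rw [← Function.comp_def, range_comp, h.surjective.range_eq, image_univ, Subtype.range_coe]
  rw [this]
  exact isPreconnected_range (by fun_prop)

/-- The arc meets the interior of the triangle. -/
lemma inter_openTriangle_nonempty (hΛ : IsRegularSelfSimilarArc ℓ q z Λ) :
    (Λ ∩ openTriangle ℓ q z).Nonempty := by
  have hB := hΛ.basicFigure
  set ζ := normCoord ℓ z (z q) with hζ
  have hζ0 : 0 < ζ.im := hB.apex_im_pos
  have hbase := hB.base_ne
  by_contra hemp
  have hnot : ∀ w ∈ Λ, w ∉ openTriangle ℓ q z := fun w hw hw' => hemp ⟨w, hw, hw'⟩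
  -- Since `z 1` and `z (ℓ - 1)` lie on the base, `S_1` and `S_ℓ` are homotheties centred at `z 0`
  -- and `z ℓ`.
  have hfirst : ∃ t : ℝ, 0 < t ∧ t < 1 ∧ ∀ w,
      normCoord ℓ z (figureMap ℓ z 1 w) = t * normCoord ℓ z w := by
    obtain ⟨s, t, hs, ht, hst, e⟩ := hB.first_mem
    have hst' : (s : ℂ) + t = 1 := by exact_mod_cast hst
    have e' : z 1 - z 0 = t * (z ℓ - z 0) := by
      rw [← e, Complex.real_smul, Complex.real_smul]
      linear_combination (z 0) * hst'
    have hr := hB.contractive 1 le_rfl hB.one_le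
    rw [Nat.sub_self, e', mul_div_cancel_right₀ _ hbase, Complex.norm_real,
      Real.norm_of_nonneg ht] at hr
    refine ⟨t, hr.1, hr.2, fun w => ?_⟩
    rw [figureMap_eq, Nat.sub_self, e', normCoord]
    field_simp
    ring
  have hlast : ∃ t : ℝ, 0 < t ∧ t < 1 ∧ ∀ w,
      normCoord ℓ z (figureMap ℓ z ℓ w) = (1 - t) + t * normCoord ℓ z w := by
    obtain ⟨s, t, hs, ht, hst, e⟩ := hB.last_mem
    have hst' : (s : ℂ) + t = 1 := by exact_mod_cast hst
    have e' : z ℓ - z (ℓ - 1) = s * (z ℓ - z 0) := by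
      rw [← e, Complex.real_smul, Complex.real_smul]
      linear_combination (-(z ℓ)) * hst'
    have hr := hB.contractive ℓ hB.one_le le_rfl
    rw [e', mul_div_cancel_right₀ _ hbase, Complex.norm_real, Real.norm_of_nonneg hs] at hr
    refine ⟨s, hr.1, hr.2, fun w => ?_⟩
    have e'' : z (ℓ - 1) = z ℓ - s * (z ℓ - z 0) := by linear_combination -e'
    rw [figureMap_eq, e', e'', normCoord]
    field_simp
    ring
  obtain ⟨t, ht0, ht1, hS1⟩ := hfirst
  obtain ⟨r, hr0, hr1, hSℓ⟩ := hlast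
  -- A point above the base and off the side through `z 0` is moved by `S_1` into the open triangle;
  -- off the side through `z ℓ`, `S_ℓ` does so. If `Λ` avoids the open triangle, its points have
  -- relative height 0 or 1. Both heights occur, at `z 0` and `z q`, which contradicts
  -- connectedness.
  have hval : ∀ w ∈ Λ, (normCoord ℓ z w).im / ζ.im = 0 ∨ (normCoord ℓ z w).im / ζ.im = 1 := by
    intro w hw
    obtain ⟨x, y, hx, hy, hxy, e⟩ := hB.mem_hull_iff.1 (hΛ.subset_hull hw)
    have him : (normCoord ℓ z w).im / ζ.im = y := by simp [e, ← hζ, hζ0.ne']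
    rw [him]
    rcases hy.eq_or_lt with hy0 | hy0
    · exact Or.inl hy0.symm
    right
    have hx0 : x = 0 := by
      by_contra hne
      have hxp := hx.lt_of_ne' hne
      refine hnot _ (hΛ.map_mem le_rfl hB.one_le hw) (hB.mem_openTriangle (mul_pos ht0 hxp)
        (mul_pos ht0 hy0) (by nlinarith) ?_)
      rw [hS1, e]
      push_cast
      ring
    have hsum : x + y = 1 := by
      by_contra hne
      have hlt := lt_of_le_of_ne hxy hne
      refine hnot _ (hΛ.map_mem hB.one_le le_rfl hw) (hB.mem_openTriangle
        (x := (1 - r) + r * x) (y := r * y) (by nlinarith) (mul_pos hr0 hy0) (by nlinarith) ?_)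
      rw [hSℓ, e]
      push_cast
      ring
    linarith
  have hcont : ContinuousOn (fun w => (normCoord ℓ z w).im / ζ.im) Λ :=
    ((Complex.continuous_im.comp (IsBasicFigure.continuous_normCoord ℓ z)).div_const _).continuousOn
  have himg := (hΛ.isPreconnected.image _ hcont).ordConnected
  have h0 : (0 : ℝ) ∈ (fun w => (normCoord ℓ z w).im / ζ.im) '' Λ :=
    ⟨z 0, hΛ.first_mem, by simp [normCoord]⟩
  have h1 : (1 : ℝ) ∈ (fun w => (normCoord ℓ z w).im / ζ.im) '' Λ :=
    ⟨z q, hΛ.vertex_mem hB.q_le, by simp [← hζ, hζ0.ne']⟩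
  obtain ⟨w, hw, he⟩ := himg.out h0 h1 (show (1 / 2 : ℝ) ∈ Icc (0 : ℝ) 1 by norm_num)
  simp only at he
  rcases hval w hw with h2 | h2 <;> rw [h2] at he <;> norm_num at he

/-- Two different pieces of the arc have no common relatively open part. -/
lemma not_subset_pieces (hΛ : IsRegularSelfSimilarArc ℓ q z Λ) {i j : ℕ} (hi : 1 ≤ i)
    (hi' : i ≤ ℓ) (hj : 1 ≤ j) (hj' : j ≤ ℓ) (hij : i ≠ j) {O : Set ℂ} (hO : IsOpen O)
    (hne : (Λ ∩ O).Nonempty) (h1 : Λ ∩ O ⊆ figureMap ℓ z i '' Λ)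
    (h2 : Λ ∩ O ⊆ figureMap ℓ z j '' Λ) : False := by
  have hB := hΛ.basicFigure
  have hdense : Λ ⊆ closure (Λ ∩ openTriangle ℓ q z) :=
    hΛ.isSimilarityChain.subset_closure inter_subset_left hΛ.inter_openTriangle_nonempty
      (fun j hj x hx => ⟨hΛ.map_mem (by omega) hj hx.1,
        hB.figureMap_mem_openTriangle (by omega) hj hx.2⟩)
  have hcont : ∀ k, Continuous (figureMap ℓ z k) := fun k => by
    unfold figureMap
    fun_prop
  obtain ⟨x, hx⟩ := hne
  obtain ⟨y, hy, rfl⟩ := h1 hx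
  have hyO : y ∈ figureMap ℓ z i ⁻¹' O := hx.2
  -- By density some `v ∈ Λ` in the open triangle has `S_i v ∈ O`, and then `S_i v = S_j u`. Since
  -- `u` is in the closed triangle, points of the open triangle near `u` have `S_j`-images in the
  -- open `S_i`-image, against disjointness.
  obtain ⟨v, hvO, hvΛ, hvT⟩ := mem_closure_iff.1 (hdense hy) _ (hO.preimage (hcont i)) hyO
  obtain ⟨u, hu, he⟩ := h2 ⟨hΛ.map_mem hi hi' hvΛ, hvO⟩
  have hopen : IsOpen (figureMap ℓ z i '' openTriangle ℓ q z) :=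
    hB.isOpenMap_figureMap hi hi' _ (IsBasicFigure.isOpen_openTriangle ℓ q z)
  have huT : u ∈ closure (openTriangle ℓ q z) := by
    have := hΛ.subset_hull hu
    rwa [← hB.closedTriangle_eq] at this
  obtain ⟨w, hw1, hw2⟩ := mem_closure_iff.1 huT _ (hopen.preimage (hcont j))
    (show figureMap ℓ z j u ∈ figureMap ℓ z i '' openTriangle ℓ q z from
      he.symm ▸ mem_image_of_mem _ hvT)
  exact disjoint_left.1 (hB.disjoint i j hi hi' hj hj' hij) hw1 (mem_image_of_mem _ hw2)

/-- Non-adjacent pieces of the arc are disjoint. -/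
lemma nonadjacent_disjoint (hΛ : IsRegularSelfSimilarArc ℓ q z Λ) {i j : ℕ} (hij : i + 1 < j)
    (hj : j < ℓ) {x y : ℂ} (hx : x ∈ Λ) (hy : y ∈ Λ) :
    figureMap ℓ z (i + 1) x ≠ figureMap ℓ z (j + 1) y := by
  have hB := hΛ.basicFigure
  obtain ⟨h⟩ := hΛ.isArc
  have hmap : ∀ k, k < ℓ → ∀ t, figureMap ℓ z (k + 1) (h t) ∈ Λ := fun k hk t =>
    hΛ.map_mem (by omega) hk (h t).2
  have hcont : ∀ k, Continuous (figureMap ℓ z k) := fun k => by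
    unfold figureMap
    fun_prop
  have hinj : ∀ k < ℓ, Function.Injective (figureMap ℓ z (k + 1)) := by
    intro k hk u v huv
    have h1 := hΛ.isSimilarityChain.dist_map k hk u v
    simp only [huv, dist_self] at h1
    exact dist_eq_zero.1 ((mul_eq_zero.1 h1.symm).resolve_left
      (hΛ.isSimilarityChain.ratio_pos k hk).ne')
  -- `P k` is the parameter set of a piece: a continuous image of `[0, 1]`, hence a compact
  -- interval.
  let P : ℕ → Set unitInterval := fun k => {t | (h t : ℂ) ∈ figureMap ℓ z (k + 1) '' Λ}
  have hPrange : ∀ k (hk : k < ℓ),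
      P k = range fun t => h.symm ⟨figureMap ℓ z (k + 1) (h t), hmap k hk t⟩ := by
    intro k hk
    ext t
    constructor
    · rintro ⟨u, hu, he⟩
      refine ⟨h.symm ⟨u, hu⟩, ?_⟩
      rw [Homeomorph.symm_apply_eq]
      apply Subtype.ext
      simpa using he
    · rintro ⟨u, rfl⟩
      exact ⟨h u, (h u).2, by simp⟩
  have hPcont : ∀ k (hk : k < ℓ),
      Continuous fun t => h.symm ⟨figureMap ℓ z (k + 1) (h t), hmap k hk t⟩ := by
    intro k hk
    refine h.symm.continuous.comp (Continuous.subtype_mk ?_ _)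
    exact (hcont _).comp (continuous_subtype_val.comp h.continuous)
  have hPIcc : ∀ k < ℓ, P k = Icc (sInf (P k)) (sSup (P k)) := by
    intro k hk
    refine eq_Icc_of_connected_compact ?_ ?_
    · rw [hPrange k hk]
      exact isConnected_range (hPcont k hk)
    · rw [hPrange k hk]
      exact isCompact_range (hPcont k hk)
  have hmem0 : ∀ k (hk : k < ℓ) (u : ℂ) (hu : u ∈ Λ),
      h.symm ⟨figureMap ℓ z (k + 1) u, hΛ.map_mem (by omega) hk hu⟩ ∈ P k := by
    intro k hk u hu
    exact ⟨u, hu, by simp⟩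
  have hlt : ∀ k < ℓ, sInf (P k) < sSup (P k) := by
    intro k hk
    have m0 := hmem0 k hk (z 0) hΛ.first_mem
    have m1 := hmem0 k hk (z ℓ) hΛ.last_mem
    by_contra hle
    rw [hPIcc k hk] at m0 m1
    have e : h.symm ⟨figureMap ℓ z (k + 1) (z 0), hΛ.map_mem (by omega) hk hΛ.first_mem⟩ =
        h.symm ⟨figureMap ℓ z (k + 1) (z ℓ), hΛ.map_mem (by omega) hk hΛ.last_mem⟩ :=
      le_antisymm (m0.2.trans ((not_lt.1 hle).trans m1.1))
        (m1.2.trans ((not_lt.1 hle).trans m0.1))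
    have e2 := hinj k hk (congrArg Subtype.val (h.symm.injective e))
    exact hB.base_ne (sub_eq_zero.2 e2.symm)
  have hdisj : Disjoint (Icc (sInf (P i)) (sSup (P i))) (Icc (sInf (P j)) (sSup (P j))) := by
    refine disjoint_of_chain_of_intervals hlt ?_ ?_ hij hj
    · intro k hk m hm hkm
      by_contra! hno
      obtain ⟨h1, h2⟩ := hno
      -- Overlapping intervals would give a relatively open part of `Λ` contained in two pieces.
      have hI : (Ioo (max (sInf (P k)) (sInf (P m))) (min (sSup (P k)) (sSup (P m)))).Nonempty :=
        nonempty_Ioo.2 (max_lt (lt_min (hlt k hk) h2) (lt_min h1 (hlt m hm)))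
      set I := Ioo (max (sInf (P k)) (sInf (P m))) (min (sSup (P k)) (sSup (P m)))
      have hV : IsOpen (h '' I) := h.isOpenMap _ isOpen_Ioo
      obtain ⟨O, hO, hOV⟩ := isOpen_induced_iff.1 hV
      have hsub : ∀ w ∈ Λ ∩ O, ∃ t ∈ I, (h t : ℂ) = w := by
        rintro w ⟨hw, hwO⟩
        have : (⟨w, hw⟩ : Λ) ∈ h '' I := hOV ▸ hwO
        obtain ⟨t, ht, he⟩ := this
        exact ⟨t, ht, by rw [he]⟩
      refine hΛ.not_subset_pieces (i := k + 1) (j := m + 1) (by omega) hk (by omega) hm (by omega)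
        hO ?_ ?_ ?_
      · obtain ⟨t, ht⟩ := hI
        have : h t ∈ Subtype.val ⁻¹' O := hOV ▸ mem_image_of_mem h ht
        exact ⟨h t, (h t).2, this⟩
      · intro w hw
        obtain ⟨t, ht, rfl⟩ := hsub w hw
        have : t ∈ P k := by
          rw [hPIcc k hk]
          exact ⟨(le_max_left _ _).trans ht.1.le, ht.2.le.trans (min_le_left _ _)⟩
        exact this
      · intro w hw
        obtain ⟨t, ht, rfl⟩ := hsub w hw
        have : t ∈ P m := by
          rw [hPIcc m hm]
          exact ⟨(le_max_right _ _).trans ht.1.le, ht.2.le.trans (min_le_right _ _)⟩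
        exact this
    · intro k hk
      refine ⟨h.symm ⟨z (k + 1), hΛ.vertex_mem hk.le⟩, ?_, ?_⟩
      · rw [← hPIcc k (by omega)]
        exact ⟨z ℓ, hΛ.last_mem, by simp [hB.figureMap_last]⟩
      · rw [← hPIcc (k + 1) hk]
        exact ⟨z 0, hΛ.first_mem, by simp [IsBasicFigure.figureMap_first]⟩
  rw [← hPIcc i (by omega), ← hPIcc j hj] at hdisj
  intro he
  have m1 := hmem0 i (by omega) x hx
  have m2 := hmem0 j hj y hy
  refine disjoint_left.1 hdisj m1 ?_
  convert m2 using 3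

/-- A regular self-similar arc with positive corner angles has a power-like parametrization. -/
theorem exists_snowflakeParametrization (hΛ : IsRegularSelfSimilarArc ℓ q z Λ)
    (hθ : 0 < minCornerAngle ℓ q z) :
    ∃ s c C : ℝ, ∃ γ : ℝ → ℂ, IsSnowflakeParametrization s c C γ Λ ∧ γ 0 = z 0 := by
  have hB := hΛ.basicFigure
  have hcorner : ∀ i, 1 ≤ i → i < ℓ → 0 < cornerAngle ℓ q z i := fun i hi hi' =>
    hθ.trans_le (csInf_le ((finite_Icc 1 (ℓ - 1)).image _).bddBelow
      (mem_image_of_mem _ ⟨hi, by omega⟩))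
  have hsep : ∀ i : ℕ, ∃ K : ℝ, 0 ≤ K ∧ (i + 1 < ℓ → ∀ u ∈ Λ, ∀ v ∈ Λ,
      dist (figureMap ℓ z (i + 1) u) (z (i + 1)) ≤
        K * dist (figureMap ℓ z (i + 1) u) (figureMap ℓ z (i + 1 + 1) v)) := by
    intro i
    by_cases hi : i + 1 < ℓ
    · obtain ⟨K, hK0, hK⟩ := hB.exists_separation (by omega) hi (hcorner (i + 1) (by omega) hi)
      exact ⟨K, hK0, fun _ u hu v hv => hK u (hΛ.subset_hull hu) v (hΛ.subset_hull hv)⟩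
    -- The default 0 keeps all constants nonnegative, so their sum serves every vertex at once.
    · exact ⟨0, le_rfl, fun h => absurd h hi⟩
  choose K hK0 hK using hsep
  obtain ⟨s, c, C, γ, hs, hc, hC, h0, himg, hest⟩ :=
    hΛ.isSimilarityChain.exists_biHolder_parametrization
      (fun h => hB.base_ne (sub_eq_zero.2 h.symm)) hB.one_lt_sum_ratio
      (fun i j hij hj x hx y hy => hΛ.nonadjacent_disjoint hij hj hx hy)
      (K := ∑ i ∈ Finset.range ℓ, K i) (Finset.sum_nonneg fun i _ => hK0 i)
      (fun i hi x hx y hy => (hK i hi x hx y hy).trans (mul_le_mul_of_nonneg_right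
        (Finset.single_le_sum (fun j _ => hK0 j) (Finset.mem_range.2 (by omega))) dist_nonneg))
  exact ⟨s, c, C, γ, ⟨hs, hc, hC, himg, fun a ha b hb => (hest a ha b hb).1,
    fun a ha b hb => (hest a ha b hb).2⟩, h0⟩

end IsRegularSelfSimilarArc

end

theorem theorem2 (ℓ q : ℕ) (z : ℕ → ℂ) (Λ : Set ℂ)
    (hΛ : IsRegularSelfSimilarArc ℓ q z Λ) (hθ : 0 < minCornerAngle ℓ q z)
    (s : ℝ) (hs : s = (dimH Λ).toReal) :
    (∀ t : ℝ, 1 ≤ t → IsTQuasiArc t Λ) ∧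
    IsQuasiArc Λ ∧
    -- the values of the Hausdorff measure function are finite
    Measure.hausdorffMeasure s Λ ≠ ⊤ ∧
    -- the function does not depend on the parametrization `h` of the arc
    ∀ h : unitInterval ≃ₜ Λ,
      IsStrictWhitneyFunctionOn Λ (hausdorffMeasureFunction h s (z 0)) := by
  obtain ⟨s', c, C, γ, hγ, h0⟩ := hΛ.exists_snowflakeParametrization hθ
  -- The Hausdorff dimension is the exponent of the parametrization.
  rw [hγ.dimH_eq] at hs
  subst hs
  refine ⟨fun t ht => hγ.isTQuasiArc ht, hγ.isTQuasiArc le_rfl, hγ.hausdorffMeasure_ne_top,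
    fun h => ?_⟩
  rw [← h0]
  exact hγ.isStrictWhitneyFunctionOn h
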